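/- Let $\Omega$ be a measurable space and let $x,y:\Omega\to[0,\infty)$ be measurable: if a solution $\omega\in\Omega$ is adopted, the principal's utility is $x(\omega)$ and the agent's utility is $y(\omega)$; if none is adopted (the status quo $\bot$) both utilities are $0$. Let $n\ge 1$. The agent draws independent samples $\omega_1,\dots,\omega_n$ from $\Omega$, which the principal does not see. For $R\subseteq\Omega$, in the single-proposal mechanism with eligible set $R$ the agent, having seen his samples, proposes $\bot$ or an element of $\Omega$; the proposal is selected if it belongs to $R$, and otherwise $\bot$ is selected. If a solution that was not sampled is selected, it cannot be adopted, and the principal gets $0$ and the agent $-1$. A strategy of the agent is a best response if, for every sequence of samples, its proposal maximizes his utility. Write $V(R,\sigma)$ for the principal's expected utility from this mechanism when the agent uses strategy $\sigma$ (a lower integral if the outcome is not a measurable function of the samples), and $\mathbb E[x_*]=\mathbb E[\max_{1\le i\le n}x(\omega_i)]$ for the value of searching herself; both may be $+\infty$. (i) (Arbitrary joint distributions.) Let $\omega_i\sim\mu_i$ be independent, where $\mu_1,\dots,\mu_n$ are arbitrary probability measures on $\Omega$ (for instance all equal). Given $n$, the $\mu_i$ and $x$ (but not $y$), there is a set $R$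 of the form $\{\omega: x(\omega)\ge\theta\}$ or $\{\omega:x(\omega)>\theta\}$ with $\theta\in\mathbb R$ such that for every $y$ and every best response $\sigma$ of the agent that, when he is indifferent between $\bot$ and a sampled eligible solution, does not bring about $\bot$, $$V(R,\sigma)\ \ge\ \tfrac12\,\mathbb E[x_*].$$ (ii) (Independent atomless utilities, the principal sees $x$ only.) Let $\omega_1,\dots,\omega_n$ be i.i.d. with law $\mu$, and let $x$ have an atomless distribution under $\mu$. Given $n$, $\mu$ and $x$ (but not $y$), there is a set $R$ of the form $\{x\ge\theta\}$ or $\{x>\theta\}$ with $\theta\in\mathbb R$ such that for every $y$ that is independent of $x$ under $\mu$ and has an atomless distribution, and for every best response $\sigma$ of the agent, $$V(R,\sigma)\ \ge\ \bigl(1-\tfrac1e\bigr)\,\mathbb E[x_*].$$ (iii) (Independent utilities, the principal sees $x$ and $y$.) There is exactly one $\alpha\in(0,1)$ with $$\int_0^1\frac{dt}{t-t\ln t-1+\frac1\alpha}=1,$$ and $0.745<\alpha<0.746$. There is an absolute constant $C$ such that the following holds for all $n\ge1$. Let $\omega_1,\dots,\omega_n$ be i.i.d. with law $\mu$, let $x$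 and $y$ be independent under $\mu$, and let $y$ have an atomless distribution. Then there are a measurable function $\theta:\mathbb R\to\mathbb R$ and a set $R$ of the form $\{\omega:x(\omega)\ge\theta(y(\omega))\}$ or $\{\omega:x(\omega)>\theta(y(\omega))\}$ such that for every best response $\sigma$ of the agent, $$V(R,\sigma)\ \ge\ \Bigl(\alpha-C\,\frac{\log n}{n}\Bigr)\mathbb E[x_*].$$ -/

import Mathlib

open MeasureTheory ProbabilityTheory
open scoped ENNReal

universe u

namespace DelegatedSearch

/-- A mechanism: a set of signals the agent may send, and an allocation function saying which
solution the principal chooses for each signal.  Outcomes are elements of `Option Ω`, where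
`none` is the null outcome `⊥` (the status quo). -/
structure Mechanism (Ω : Type u) : Type (u + 1) where
  Signal : Type u
  alloc : Signal → Option Ω

/-- A strategy of an agent who samples `n` solutions: the signal sent for each sample sequence. -/
abbrev Strategy {Ω : Type u} (M : Mechanism Ω) (n : ℕ) : Type u :=
  (Fin n → Ω) → M.Signal

open Classical in
/-- The single-proposal mechanism with eligible set `R`: the agent proposes an outcome, which is
adopted if it lies in `R`, and the status quo is kept otherwise. -/
noncomputable def singleProposal {Ω : Type u} (R : Set Ω) : Mechanism Ω where
  Signal := Option Ω
  alloc
    | none => none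
    | some ω => if ω ∈ R then some ω else none

open Classical in
/-- The principal's utility from an outcome when the agent sampled `s`: `0` for the null outcome,
`x ω` for a solution `ω` that was sampled, and `0` for a solution that was not sampled. -/
noncomputable def principalUtility {Ω : Type u} {n : ℕ} (x : Ω → ℝ) (s : Fin n → Ω) :
    Option Ω → ℝ
  | none => 0
  | some ω => if ω ∈ Set.range s then x ω else 0

open Classical in
/-- The agent's utility from an outcome when he sampled `s`: `0` for the null outcome,
`y ω` for a solution `ω` that was sampled, and `-1` for a solution that was not sampled. -/
noncomputable def agentUtility {Ω : Type u} {n : ℕ} (y : Ω → ℝ) (s : Fin n → Ω) :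
    Option Ω → ℝ
  | none => 0
  | some ω => if ω ∈ Set.range s then y ω else -1

/-- The strategy `σ` is a best response to `M`: for every sample sequence, no signal is better for
the agent than the one prescribed by `σ`. -/
def IsBestResponse {Ω : Type u} {n : ℕ} (M : Mechanism Ω) (y : Ω → ℝ) (σ : Strategy M n) : Prop :=
  ∀ (s : Fin n → Ω) (m : M.Signal),
    agentUtility y s (M.alloc m) ≤ agentUtility y s (M.alloc (σ s))

/-- Tie-breaking against the status quo: the agent brings about the null outcome only if every
sampled solution that he could get adopted has strictly negative utility for him. -/
def AdoptsWhenIndifferent {Ω : Type u} {n : ℕ} (M : Mechanism Ω) (y : Ω → ℝ)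
    (σ : Strategy M n) : Prop :=
  ∀ s : Fin n → Ω, M.alloc (σ s) = none →
    ∀ (m : M.Signal) (i : Fin n), M.alloc m = some (s i) → y (s i) < 0

/-- `E[max_i x(ω_i)]` for independent `ω_i ∼ μ i`: the value of searching without delegation. -/
noncomputable def searchValue {Ω : Type u} [MeasurableSpace Ω] {n : ℕ}
    (μ : Fin n → Measure Ω) (x : Ω → ℝ) : ℝ≥0∞ :=
  ∫⁻ s, ⨆ i, ENNReal.ofReal (x (s i)) ∂(Measure.pi μ)

/-- The principal's expected utility (for `x ≥ 0`) from the mechanism `M` when the agent plays `σ`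
and the samples are independent with `ω_i ∼ μ i`.  For a non-measurable strategy this is the lower
integral, so that lower bounds on it are meaningful for every strategy. -/
noncomputable def delegationValue {Ω : Type u} [MeasurableSpace Ω] {n : ℕ}
    (μ : Fin n → Measure Ω) (x : Ω → ℝ) (M : Mechanism Ω) (σ : Strategy M n) : ℝ≥0∞ :=
  ∫⁻ s, ENNReal.ofReal (principalUtility x s (M.alloc (σ s))) ∂(Measure.pi μ)

/-- `R` is the eligible set of a weak or strict threshold on the principal's utility `x`. -/
def IsThresholdSet {Ω : Type u} (x : Ω → ℝ) (R : Set Ω) : Prop :=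
  ∃ θ : ℝ, R = {ω | θ ≤ x ω} ∨ R = {ω | θ < x ω}

/-- `R` is the eligible set of a weak or strict threshold on the principal's utility `x`, where the
threshold is a function of the agent's utility `y`. -/
def IsThresholdFunctionSet {Ω : Type u} (x y : Ω → ℝ) (R : Set Ω) : Prop :=
  ∃ θ : ℝ → ℝ, Measurable θ ∧ (R = {ω | θ (y ω) ≤ x ω} ∨ R = {ω | θ (y ω) < x ω})

/-- The real random variable `f` is atomless under `μ`. -/
def Atomless {Ω : Type u} [MeasurableSpace Ω] (μ : Measure Ω) (f : Ω → ℝ) : Prop :=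
  ∀ c : ℝ, μ {ω | f ω = c} = 0

end DelegatedSearch

/-! Every lower bound on the value integrates a measurable function lying pointwise below the
principal's utility, built from events on which the agent's choice is forced enough. So no
measurability of the strategy is needed. Write n = m + 1.

(i) This is the prophet-inequality argument. For every θ ≥ 0 the benchmark is at most θ + Σ E(x_i -
θ)^+ (`searchValue_le_add_sum`). Delegation with eligible set {x ≥ θ} yields θ whenever some sample
is eligible, plus the excess x_i - θ when sample i alone is eligible. Hence it yields at least
θ·P(some eligible) + P(none eligible)·Σ E(x_i - θ)^+. With θ half the benchmark, both coefficients
are at least θ.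

(ii) If eligibility depends on x alone and y is independent of x, the agent's choice among eligible
samples carries no information on x. With q = P(x > θ), the value is at least (1 - (1 - q)^n) E[x; x
> θ] / q (`mul_setLIntegral_le_delegationValue`). At q = 1/n the benchmark is at most n E[x; x > θ],
and (1 - 1/n)^n ≤ 1/e.

(iii) Read the upper tail probability of y as a time, uniform on [0, 1]: the agent adopts the
earliest eligible sample, so a threshold depending on y is a threshold depending on time, as in the
i.i.d. prophet problem. Let ρ(u) be the best partial expectation of x at acceptance probability u.
Integrating 1 - (1 - g)^n = n ∫ m (1 - u)^(m-1) min(u, g) du over the tails g of x shows that the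
benchmark is n times the mean of ρ(u) under the density m (1 - u)^(m-1)
(`searchValue_le_sum_topMass` is a discrete form). The schedule uses quantile u for a time c·dw/P^m,
where dw is that density and P is the probability that a given sample has not yet been accepted. It
then collects exactly the fraction c of each cell.

The dynamics give P^n = 1 - c (1 - n v^m + m v^n) with v = 1 - u. Since n v^m - m v^n is close to s
- s log s for s = v^m, the total time tends to the integral of ds / (s - s log s - 1 + 1/c), which
is 1 at c = α. `exists_schedule` makes this quantitative with loss 4/n.

When x has atoms a quantile would need randomization. `exists_thresholds_ge_quantiles` removes it:
at each stage a deterministic threshold equal to the marginal value of survival does no worse, by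
Lagrangian duality and convexity of z ↦ max(0, z)^m. -/

namespace DelegatedSearch

variable {Ω : Type u}

/-! ### Best responses in the single-proposal mechanism -/

/-- If sample `i` is eligible, has positive utility for the agent and beats all other eligible
samples, every best response gets it adopted. -/
lemma principalUtility_of_unique_best {n : ℕ} {R : Set Ω} {x y : Ω → ℝ}
    {σ : Strategy (singleProposal R) n} (hσ : IsBestResponse (singleProposal R) y σ)
    {s : Fin n → Ω} {i : Fin n} (hi : s i ∈ R) (hpos : 0 < y (s i))
    (hbest : ∀ j, j ≠ i → s j ∈ R → y (s j) < y (s i)) :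
    principalUtility x s ((singleProposal R).alloc (σ s)) = x (s i) := by
  have h := hσ s (some (s i))
  have h1 : (singleProposal R).alloc (some (s i)) = some (s i) := by simp [singleProposal, hi]
  have h2 : agentUtility y s (some (s i)) = y (s i) := by simp [agentUtility]
  rw [h1, h2] at h
  have hR : ∀ ω, (singleProposal R).alloc (σ s) = some ω → ω ∈ R := by
    intro ω hω
    cases hs : σ s with
    | none => rw [hs] at hω; simp [singleProposal] at hω
    | some ω' =>
      rw [hs] at hω
      by_cases hm : ω' ∈ R
      · simp [singleProposal, hm] at hω; exact hω ▸ hm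
      · simp [singleProposal, hm] at hω
  cases ho : (singleProposal R).alloc (σ s) with
  | none => rw [ho] at h; simp only [agentUtility] at h; linarith
  | some ω =>
    have hωR := hR ω ho
    rw [ho] at h
    by_cases hr : ω ∈ Set.range s
    · obtain ⟨j, rfl⟩ := hr
      have h3 : agentUtility y s (some (s j)) = y (s j) := by simp [agentUtility]
      rw [h3] at h
      by_cases hj : j = i
      · subst hj; simp [principalUtility]
      · exact absurd (hbest j hj hωR) (not_lt.2 h)
    · simp only [agentUtility, if_neg hr] at h; linarith

/-- A best response that breaks ties against the status quo gets an eligible sample adopted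
whenever there is one. -/
lemma exists_principalUtility_eq {n : ℕ} {R : Set Ω} {x y : Ω → ℝ} (hy : ∀ ω, 0 ≤ y ω)
    {σ : Strategy (singleProposal R) n} (hσ : IsBestResponse (singleProposal R) y σ)
    (ha : AdoptsWhenIndifferent (singleProposal R) y σ)
    {s : Fin n → Ω} {i : Fin n} (hi : s i ∈ R) :
    ∃ j, s j ∈ R ∧ principalUtility x s ((singleProposal R).alloc (σ s)) = x (s j) := by
  have h := hσ s (some (s i))
  have h1 : (singleProposal R).alloc (some (s i)) = some (s i) := by simp [singleProposal, hi]
  have h2 : agentUtility y s (some (s i)) = y (s i) := by simp [agentUtility]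
  rw [h1, h2] at h
  cases ho : (singleProposal R).alloc (σ s) with
  | none => exact absurd (hy (s i)) (not_le.2 (ha s ho (some (s i)) i h1))
  | some ω =>
    have hωR : ω ∈ R := by
      cases hs : σ s with
      | none => rw [hs] at ho; simp [singleProposal] at ho
      | some ω' =>
        rw [hs] at ho
        by_cases hm : ω' ∈ R
        · simp [singleProposal, hm] at ho; exact ho ▸ hm
        · simp [singleProposal, hm] at ho
    rw [ho] at h
    by_cases hr : ω ∈ Set.range s
    · obtain ⟨j, rfl⟩ := hr
      exact ⟨j, hωR, by simp [principalUtility]⟩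
    · simp only [agentUtility, if_neg hr] at h
      linarith [hy (s i)]

variable [MeasurableSpace Ω]

/-! ### Fubini over the samples and a lower bound for atomless agent utility -/

/-- The event that sample `i` stands in relation `K` to all the other samples is measurable. -/
lemma measurableSet_forall_ne {n : ℕ} {K : Set (Ω × Ω)} (hK : MeasurableSet K) (i : Fin n) :
    MeasurableSet {s : Fin n → Ω | ∀ j, j ≠ i → (s i, s j) ∈ K} := by
  simp only [Set.ofPred_forall]
  refine MeasurableSet.iInter fun j => MeasurableSet.iInter fun _ => ?_
  exact hK.preimage ((measurable_pi_apply i).prodMk (measurable_pi_apply j))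

/-- Fubini for a function of sample `i`, on the event that sample `i` stands in relation `K` to all
the others. -/
lemma setLIntegral_pi_forall_ne {m : ℕ} (μ : Fin (m + 1) → Measure Ω)
    [∀ i, IsProbabilityMeasure (μ i)] {f : Ω → ℝ≥0∞} (hf : Measurable f) {K : Set (Ω × Ω)}
    (hK : MeasurableSet K) (i : Fin (m + 1)) :
    ∫⁻ s in {s : Fin (m + 1) → Ω | ∀ j, j ≠ i → (s i, s j) ∈ K}, f (s i) ∂(Measure.pi μ) =
      ∫⁻ ω, f ω * ∏ j : Fin m, μ (i.succAbove j) (Prod.mk ω ⁻¹' K) ∂(μ i) := by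
  have hA := measurableSet_forall_ne hK i
  rw [← lintegral_indicator hA]
  have hmp := measurePreserving_piFinSuccAbove μ i
  set B : Set (Ω × (Fin m → Ω)) := {p | ∀ j, (p.1, p.2 j) ∈ K} with hB
  have hBm : MeasurableSet B := by
    rw [hB, Set.ofPred_forall]
    exact MeasurableSet.iInter fun j =>
      hK.preimage (measurable_fst.prodMk ((measurable_pi_apply j).comp measurable_snd))
  have hg : Measurable (B.indicator fun p => f p.1) := (hf.comp measurable_fst).indicator hBm
  have key : ∀ s : Fin (m + 1) → Ω,
      ({s : Fin (m + 1) → Ω | ∀ j, j ≠ i → (s i, s j) ∈ K}.indicator fun s => f (s i)) s =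
      (B.indicator fun p => f p.1) (MeasurableEquiv.piFinSuccAbove (fun _ => Ω) i s) := by
    intro s
    have : s ∈ {s : Fin (m + 1) → Ω | ∀ j, j ≠ i → (s i, s j) ∈ K} ↔
        MeasurableEquiv.piFinSuccAbove (fun _ => Ω) i s ∈ B := by
      constructor
      · intro h j
        exact h _ (Fin.succAbove_ne i j)
      · intro h j hj
        obtain ⟨k, rfl⟩ := Fin.exists_succAbove_eq hj
        exact h k
    by_cases hs : s ∈ {s : Fin (m + 1) → Ω | ∀ j, j ≠ i → (s i, s j) ∈ K}
    · rw [Set.indicator_of_mem hs, Set.indicator_of_mem (this.1 hs)]; rfl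
    · rw [Set.indicator_of_notMem hs, Set.indicator_of_notMem (fun h => hs (this.2 h))]
  simp_rw [key]
  rw [hmp.lintegral_comp hg, lintegral_prod _ hg.aemeasurable]
  refine lintegral_congr fun ω => ?_
  have h1 : ∀ t : Fin m → Ω, (B.indicator fun p => f p.1) (ω, t) =
      (Set.univ.pi fun _ : Fin m => Prod.mk ω ⁻¹' K).indicator (fun _ => f ω) t := by
    intro t
    by_cases ht : (ω, t) ∈ B
    · rw [Set.indicator_of_mem ht, Set.indicator_of_mem]
      exact fun j _ => ht j
    · rw [Set.indicator_of_notMem ht, Set.indicator_of_notMem]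
      exact fun h => ht fun j => h j trivial
  simp_rw [h1]
  rw [lintegral_indicator_const, Measure.pi_pi]
  exact MeasurableSet.univ_pi fun _ => hK.preimage measurable_prodMk_left

/-- Lower bound for the value of delegation with i.i.d. samples and atomless agent utility: sample
`ω` is adopted if it is eligible and the agent strictly prefers it to the other eligible ones. -/
lemma le_delegationValue {m : ℕ} (μ : Measure Ω) [IsProbabilityMeasure μ] {x y : Ω → ℝ}
    (hx : Measurable x) (hy : Measurable y) (hy0 : ∀ ω, 0 ≤ y ω) (hya : Atomless μ y)
    {R : Set Ω} (hR : MeasurableSet R) {σ : Strategy (singleProposal R) (m + 1)}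
    (hσ : IsBestResponse (singleProposal R) y σ) :
    (m + 1 : ℝ≥0∞) * ∫⁻ ω in R, ENNReal.ofReal (x ω) * μ {ω' | ω' ∈ R → y ω' < y ω} ^ m ∂μ ≤
      delegationValue (fun _ : Fin (m + 1) => μ) x (singleProposal R) σ := by
  set K : Set (Ω × Ω) := {p | p.2 ∈ R → y p.2 < y p.1} with hK
  have hKm : MeasurableSet K := by
    have : K = (Prod.snd ⁻¹' R)ᶜ ∪ {p | y p.2 < y p.1} := by
      ext p; simp only [hK, Set.mem_ofPred_eq, Set.mem_union, Set.mem_compl_iff, Set.mem_preimage]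
      tauto
    rw [this]
    exact (hR.preimage measurable_snd).compl.union
      (measurableSet_lt (hy.comp measurable_snd) (hy.comp measurable_fst))
  -- At y = 0 the agent may bring about the null outcome. Atomlessness makes that event null, so `E`
  -- loses nothing against `R`.
  set E : Set Ω := R ∩ {ω | 0 < y ω} with hE
  have hEm : MeasurableSet E := hR.inter (measurableSet_lt measurable_const hy)
  set f : Ω → ℝ≥0∞ := E.indicator fun ω => ENNReal.ofReal (x ω) with hf
  have hfm : Measurable f := hx.ennreal_ofReal.indicator hEm
  have hEae : E =ᵐ[μ] R := by
    have h0 : ∀ᵐ ω ∂μ, 0 < y ω := by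
      have : ∀ᵐ ω ∂μ, y ω ≠ 0 := by
        rw [ae_iff]; simpa using hya 0
      filter_upwards [this] with ω h
      exact lt_of_le_of_ne (hy0 ω) (Ne.symm h)
    filter_upwards [h0] with ω h
    apply propext
    exact ⟨fun hh => hh.1, fun hh => ⟨hh, h⟩⟩
  have hint : ∀ i : Fin (m + 1),
      ∫⁻ s in {s : Fin (m + 1) → Ω | ∀ j, j ≠ i → (s i, s j) ∈ K}, f (s i)
        ∂(Measure.pi fun _ : Fin (m + 1) => μ) =
      ∫⁻ ω in R, ENNReal.ofReal (x ω) * μ {ω' | ω' ∈ R → y ω' < y ω} ^ m ∂μ := by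
    intro i
    rw [setLIntegral_pi_forall_ne (fun _ => μ) hfm hKm i, ← setLIntegral_congr hEae,
      ← lintegral_indicator hEm]
    refine lintegral_congr fun ω => ?_
    by_cases hω : ω ∈ E
    · simp only [hf, Set.indicator_of_mem hω, Finset.prod_const, Finset.card_univ,
        Fintype.card_fin]
      rfl
    · simp only [hf, Set.indicator_of_notMem hω, zero_mul]
  have hsum : (m + 1 : ℝ≥0∞) *
      ∫⁻ ω in R, ENNReal.ofReal (x ω) * μ {ω' | ω' ∈ R → y ω' < y ω} ^ m ∂μ =
      ∑ i : Fin (m + 1), ∫⁻ s in {s : Fin (m + 1) → Ω | ∀ j, j ≠ i → (s i, s j) ∈ K}, f (s i)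
        ∂(Measure.pi fun _ : Fin (m + 1) => μ) := by
    simp_rw [hint]
    simp
  rw [hsum]
  simp_rw [← lintegral_indicator (measurableSet_forall_ne hKm _)]
  rw [← lintegral_finsetSum]
  swap
  · intro i _
    exact (hfm.comp (measurable_pi_apply i)).indicator (measurableSet_forall_ne hKm i)
  refine lintegral_mono fun s => ?_
  -- Two samples cannot both beat all other eligible ones, so at most one summand is nonzero.
  by_cases hs : ∃ i, s i ∈ E ∧ ∀ j, j ≠ i → (s i, s j) ∈ K
  · obtain ⟨i, hi, hiK⟩ := hs
    rw [principalUtility_of_unique_best hσ hi.1 hi.2 hiK, Finset.sum_eq_single i]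
    · refine (Set.indicator_le_self _ _ s).trans ?_
      simp only [hf, Set.indicator_of_mem hi]; exact le_rfl
    · intro j _ hj
      by_cases hjE : s j ∈ E
      · rw [Set.indicator_of_notMem]
        intro hjK
        exact lt_asymm (hiK j hj hjE.1) (hjK i hj.symm hi.1)
      · apply Set.indicator_apply_eq_zero.2
        intro _
        simp only [hf, Set.indicator_of_notMem hjE]
    · simp
  · rw [Finset.sum_eq_zero]
    · exact zero_le
    · intro i _
      by_cases hiE : s i ∈ E
      · rw [Set.indicator_of_notMem]
        exact fun h => hs ⟨i, hiE, h⟩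
      · apply Set.indicator_apply_eq_zero.2
        intro _
        simp only [hf, Set.indicator_of_notMem hiE]

/-! ### Half of the benchmark for arbitrary joint distributions -/

lemma lintegral_pi_eval {n : ℕ} (μ : Fin n → Measure Ω) [∀ i, IsProbabilityMeasure (μ i)]
    {f : Ω → ℝ≥0∞} (hf : Measurable f) (i : Fin n) :
    ∫⁻ s, f (s i) ∂(Measure.pi μ) = ∫⁻ ω, f ω ∂(μ i) :=
  (measurePreserving_eval μ i).lintegral_comp hf

/-- The expected maximum is at most a threshold plus the expected excesses over it. -/
lemma searchValue_le_add_sum {n : ℕ} (μ : Fin n → Measure Ω) [∀ i, IsProbabilityMeasure (μ i)]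
    {x : Ω → ℝ} (hx : Measurable x) (θ : ℝ) :
    searchValue μ x ≤
      ENNReal.ofReal θ + ∑ i, ∫⁻ ω, ENNReal.ofReal (x ω - θ) ∂(μ i) := by
  have hm : Measurable fun ω => ENNReal.ofReal (x ω - θ) := (hx.sub_const θ).ennreal_ofReal
  have h : ENNReal.ofReal θ + ∑ i, ∫⁻ ω, ENNReal.ofReal (x ω - θ) ∂(μ i) =
      ∫⁻ s, (ENNReal.ofReal θ + ∑ i, ENNReal.ofReal (x (s i) - θ)) ∂(Measure.pi μ) := by
    rw [lintegral_add_left measurable_const, lintegral_const, measure_univ, mul_one,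
      lintegral_finsetSum]
    · simp_rw [lintegral_pi_eval μ hm]
    · exact fun i _ => hm.comp (measurable_pi_apply i)
  rw [h]
  refine lintegral_mono fun s => iSup_le fun i => ?_
  calc ENNReal.ofReal (x (s i)) = ENNReal.ofReal (θ + (x (s i) - θ)) := by ring_nf
    _ ≤ ENNReal.ofReal θ + ENNReal.ofReal (x (s i) - θ) := ENNReal.ofReal_add_le
    _ ≤ _ := by
      gcongr
      exact Finset.single_le_sum (f := fun i => ENNReal.ofReal (x (s i) - θ))
        (fun _ _ => zero_le) (Finset.mem_univ i)

/-- Lower bound for the value of delegation with a threshold, for arbitrary joint distributions: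
the threshold if some sample is eligible, and the excess over the threshold if exactly one is. -/
lemma threshold_add_excess_le_delegationValue {m : ℕ} (μ : Fin (m + 1) → Measure Ω)
    [∀ i, IsProbabilityMeasure (μ i)] {x y : Ω → ℝ} (hx : Measurable x) (hy0 : ∀ ω, 0 ≤ y ω)
    {θ : ℝ} (hθ : 0 ≤ θ) {σ : Strategy (singleProposal {ω | θ ≤ x ω}) (m + 1)}
    (hσ : IsBestResponse (singleProposal {ω | θ ≤ x ω}) y σ)
    (ha : AdoptsWhenIndifferent (singleProposal {ω | θ ≤ x ω}) y σ) :
    ENNReal.ofReal θ * Measure.pi μ {s | ∀ i, x (s i) < θ}ᶜ +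
        (∑ i, ∫⁻ ω, ENNReal.ofReal (x ω - θ) ∂(μ i)) * Measure.pi μ {s | ∀ i, x (s i) < θ} ≤
      delegationValue μ x (singleProposal {ω | θ ≤ x ω}) σ := by
  have hm : Measurable fun ω => ENNReal.ofReal (x ω - θ) := (hx.sub_const θ).ennreal_ofReal
  set K : Set (Ω × Ω) := {p | x p.2 < θ} with hK
  have hKm : MeasurableSet K := measurableSet_lt (hx.comp measurable_snd) measurable_const
  set N : Set (Fin (m + 1) → Ω) := {s | ∀ i, x (s i) < θ} with hN
  have hNpi : N = Set.univ.pi fun _ => {ω | x ω < θ} := by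
    ext s; simp [hN]
  have hNm : MeasurableSet N := by
    rw [hNpi]; exact MeasurableSet.univ_pi fun _ => measurableSet_lt hx measurable_const
  have hone : ∀ i, (∫⁻ ω, ENNReal.ofReal (x ω - θ) ∂(μ i)) * Measure.pi μ N ≤
      ∫⁻ s in {s : Fin (m + 1) → Ω | ∀ j, j ≠ i → (s i, s j) ∈ K},
        ENNReal.ofReal (x (s i) - θ) ∂(Measure.pi μ) := by
    intro i
    rw [setLIntegral_pi_forall_ne μ hm hKm i, ← lintegral_mul_const _ hm]
    refine lintegral_mono fun ω => ?_
    dsimp only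
    gcongr
    -- "No other sample eligible" is at least as likely as "no sample eligible": the factor of
    -- sample i is at most 1.
    rw [hNpi, Measure.pi_pi, Fin.prod_univ_succAbove _ i]
    exact mul_le_of_le_one_left' prob_le_one
  rw [Finset.sum_mul]
  refine (add_le_add_right (Finset.sum_le_sum fun i _ => hone i) _).trans ?_
  rw [← lintegral_indicator_const hNm.compl]
  simp_rw [← lintegral_indicator (measurableSet_forall_ne hKm _)]
  rw [← lintegral_finsetSum, ← lintegral_add_left]
  · refine lintegral_mono fun s => ?_
    by_cases hs : s ∈ N
    · rw [Set.indicator_of_notMem (show s ∉ Nᶜ from not_not.2 hs), zero_add, Finset.sum_eq_zero]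
      · exact zero_le
      · intro i _
        apply Set.indicator_apply_eq_zero.2
        intro _
        exact ENNReal.ofReal_of_nonpos (by linarith [hs i])
    · obtain ⟨i, hi⟩ : ∃ i, θ ≤ x (s i) := by
        by_contra h
        push Not at h
        exact hs h
      obtain ⟨j, hj, hv⟩ := exists_principalUtility_eq (x := x) hy0 hσ ha (i := i) hi
      have hj' : θ ≤ x (s j) := hj
      rw [Set.indicator_of_mem (show s ∈ Nᶜ from hs), hv, Finset.sum_eq_single j]
      · refine (add_le_add_right (Set.indicator_le_self _ _ s) _).trans ?_
        rw [← ENNReal.ofReal_add hθ (by linarith)]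
        simp
      · intro k _ hk
        rw [Set.indicator_of_notMem]
        intro h
        exact not_lt.2 hj' (h j hk.symm)
      · simp
  · exact measurable_const.indicator hNm.compl
  · intro i _
    exact (hm.comp (measurable_pi_apply i)).indicator (measurableSet_forall_ne hKm i)

/-- Some threshold on the principal's utility gives half of the value of searching directly,
whatever the joint distribution of the utilities. -/
theorem exists_threshold_half {n : ℕ} (μ : Fin n → Measure Ω) [∀ i, IsProbabilityMeasure (μ i)]
    {x : Ω → ℝ} (hn : 1 ≤ n) (hx : Measurable x) :
    ∃ R : Set Ω, IsThresholdSet x R ∧ ∀ y : Ω → ℝ, (∀ ω, 0 ≤ y ω) →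
      ∀ σ : Strategy (singleProposal R) n, IsBestResponse (singleProposal R) y σ →
        AdoptsWhenIndifferent (singleProposal R) y σ →
        ENNReal.ofReal (1 / 2) * searchValue μ x ≤ delegationValue μ x (singleProposal R) σ := by
  obtain ⟨m, rfl⟩ : ∃ m, n = m + 1 := ⟨n - 1, by omega⟩
  by_cases hM : searchValue μ x = ∞
  -- With an infinite benchmark the excess over any finite threshold is infinite; it remains to pick
  -- a threshold below which all samples fall with positive probability.
  · obtain ⟨k, hk⟩ : ∃ k : ℕ, Measure.pi μ {s | ∀ i, x (s i) < (k : ℝ)} ≠ 0 := by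
      by_contra h
      push Not at h
      have h0 := measure_iUnion_null h
      have h1 : (⋃ k : ℕ, {s : Fin (m + 1) → Ω | ∀ i, x (s i) < (k : ℝ)}) = Set.univ := by
        refine Set.eq_univ_of_forall fun s => Set.mem_iUnion.2 ?_
        obtain ⟨k, hk⟩ := exists_nat_gt (∑ i, |x (s i)|)
        refine ⟨k, fun i => lt_of_le_of_lt ?_ hk⟩
        exact (le_abs_self _).trans (Finset.single_le_sum (f := fun i => |x (s i)|)
          (fun _ _ => abs_nonneg _) (Finset.mem_univ i))
      rw [h1, measure_univ] at h0
      exact one_ne_zero h0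
    refine ⟨{ω | (k : ℝ) ≤ x ω}, ⟨k, Or.inl rfl⟩, fun y hy0 σ hσ ha => ?_⟩
    have h := threshold_add_excess_le_delegationValue μ hx hy0 (Nat.cast_nonneg k) hσ ha
    have hA := searchValue_le_add_sum μ hx (k : ℝ)
    rw [hM, top_le_iff, ENNReal.add_eq_top] at hA
    rw [hA.resolve_left ENNReal.ofReal_ne_top, ENNReal.top_mul hk, add_top, top_le_iff] at h
    rw [h]
    exact le_top
  · set θ := (searchValue μ x).toReal / 2 with hθ
    have hθ0 : 0 ≤ θ := by positivity
    have h2 : ENNReal.ofReal (1 / 2) * searchValue μ x = ENNReal.ofReal θ := by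
      rw [← ENNReal.ofReal_toReal hM, ← ENNReal.ofReal_mul (by norm_num)]
      congr 1
      rw [hθ]; ring
    have h3 : searchValue μ x = ENNReal.ofReal θ + ENNReal.ofReal θ := by
      rw [← ENNReal.ofReal_add hθ0 hθ0, ← ENNReal.ofReal_toReal hM]
      congr 1
      rw [hθ]; ring
    refine ⟨{ω | θ ≤ x ω}, ⟨θ, Or.inl rfl⟩, fun y hy0 σ hσ ha => ?_⟩
    refine le_trans ?_ (threshold_add_excess_le_delegationValue μ hx hy0 hθ0 hσ ha)
    have hA := searchValue_le_add_sum μ hx θ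
    rw [h3, ENNReal.add_le_add_iff_left ENNReal.ofReal_ne_top] at hA
    have hNm : MeasurableSet {s : Fin (m + 1) → Ω | ∀ i, x (s i) < θ} := by
      rw [Set.ofPred_forall]
      exact MeasurableSet.iInter fun i =>
        measurableSet_lt (hx.comp (measurable_pi_apply i)) measurable_const
    calc ENNReal.ofReal (1 / 2) * searchValue μ x = ENNReal.ofReal θ * 1 := by rw [h2, mul_one]
      _ = ENNReal.ofReal θ * Measure.pi μ {s | ∀ i, x (s i) < θ}ᶜ +
          ENNReal.ofReal θ * Measure.pi μ {s | ∀ i, x (s i) < θ} := by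
        rw [← mul_add, add_comm, measure_add_measure_compl hNm, measure_univ]
      _ ≤ _ := by gcongr

/-! ### Upper quantiles of atomless random variables -/

lemma measureReal_lt_eq_one_sub_cdf (μ : Measure Ω) [IsProbabilityMeasure μ] {f : Ω → ℝ}
    (hf : Measurable f) (v : ℝ) : μ.real {ω | v < f ω} = 1 - cdf (μ.map f) v := by
  have := Measure.isProbabilityMeasure_map (μ := μ) hf.aemeasurable
  rw [cdf_eq_real, map_measureReal_apply hf measurableSet_Iic,
    ← probReal_compl_eq_one_sub (hf measurableSet_Iic)]
  congr 1
  ext ω; simp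

/-- The jump of the cdf at a point is the mass of that point. -/
lemma continuous_measureReal_lt {μ : Measure Ω} [IsProbabilityMeasure μ] {f : Ω → ℝ}
    (hf : Measurable f) (hfa : Atomless μ f) : Continuous fun v => μ.real {ω | v < f ω} := by
  have := Measure.isProbabilityMeasure_map (μ := μ) hf.aemeasurable
  simp_rw [measureReal_lt_eq_one_sub_cdf μ hf]
  refine continuous_const.sub (continuous_iff_continuousAt.2 fun v => ?_)
  rw [(monotone_cdf _).continuousAt_iff_leftLim_eq_rightLim, StieltjesFunction.rightLim_eq]
  have h : (cdf (μ.map f)).measure {v} = 0 := by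
    rw [measure_cdf, Measure.map_apply hf (measurableSet_singleton v)]
    exact hfa v
  rw [StieltjesFunction.measure_singleton, ENNReal.ofReal_eq_zero] at h
  exact le_antisymm ((monotone_cdf _).leftLim_le le_rfl) (by linarith)

/-- An atomless random variable has an upper quantile of every order. -/
lemma exists_measureReal_lt_eq {μ : Measure Ω} [IsProbabilityMeasure μ] {f : Ω → ℝ}
    (hf : Measurable f) (hfa : Atomless μ f) {t : ℝ} (h0 : 0 < t) (h1 : t < 1) :
    ∃ v, μ.real {ω | v < f ω} = t := by
  have hbot := (tendsto_cdf_atBot (μ.map f)).eventually (gt_mem_nhds (show 0 < 1 - t by linarith))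
  have htop := (tendsto_cdf_atTop (μ.map f)).eventually (lt_mem_nhds (show 1 - t < 1 by linarith))
  obtain ⟨a, ha⟩ := hbot.exists
  obtain ⟨b, hb⟩ := htop.exists
  refine mem_range_of_exists_le_of_exists_ge (continuous_measureReal_lt hf hfa) ⟨b, ?_⟩ ⟨a, ?_⟩
  · rw [measureReal_lt_eq_one_sub_cdf μ hf]; linarith
  · rw [measureReal_lt_eq_one_sub_cdf μ hf]; linarith

/-- The upper tail probability at an atomless random variable is uniform on `[0, 1]`. -/
lemma measureReal_tail_lt {μ : Measure Ω} [IsProbabilityMeasure μ] {f : Ω → ℝ}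
    (hf : Measurable f) (hfa : Atomless μ f) {t : ℝ} (h0 : 0 ≤ t) (h1 : t ≤ 1) :
    μ.real {ω | μ.real {ω' | f ω < f ω'} < t} = t := by
  have anti : ∀ {v w : ℝ}, v ≤ w → μ.real {ω | w < f ω} ≤ μ.real {ω | v < f ω} :=
    fun h => measureReal_mono fun ω hω => lt_of_le_of_lt h hω
  apply le_antisymm
  · rcases eq_or_lt_of_le h1 with rfl | h1
    · exact measureReal_le_one
    rcases eq_or_lt_of_le h0 with rfl | h0
    · have : {ω | μ.real {ω' | f ω < f ω'} < 0} = ∅ := by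
        ext ω; simp [measureReal_nonneg]
      rw [this]; simp
    obtain ⟨b, hb⟩ := exists_measureReal_lt_eq hf hfa h0 h1
    conv_rhs => rw [← hb]
    refine measureReal_mono fun ω hω => ?_
    by_contra h
    have h' := anti (not_lt.1 h)
    rw [hb] at h'
    exact absurd hω (not_lt.2 h')
  · refine le_of_forall_lt fun c hc => ?_
    rcases lt_or_ge c 0 with hc0 | hc0
    · exact hc0.trans_le measureReal_nonneg
    obtain ⟨d, hcd, hdt⟩ := exists_between hc
    obtain ⟨b, hb⟩ := exists_measureReal_lt_eq hf hfa (hc0.trans_lt hcd) (hdt.trans_le h1)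
    refine hcd.trans_le ?_
    rw [← hb]
    refine measureReal_mono fun ω hω => ?_
    have h' := anti (le_of_lt hω)
    rw [hb] at h'
    exact lt_of_le_of_lt h' hdt

/-! ### Independent utilities with a threshold on `x` alone -/

/-- Factorization of a partial expectation over an event that depends on `f` only. -/
lemma setLIntegral_preimage_mul_of_indepFun {μ : Measure Ω} {f g : Ω → ℝ} (hf : Measurable f)
    (hg : Measurable g) (hfg : IndepFun f g μ) {φ ψ : ℝ → ℝ≥0∞} (hφ : Measurable φ)
    (hψ : Measurable ψ) {S : Set ℝ} (hS : MeasurableSet S) :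
    ∫⁻ ω in f ⁻¹' S, φ (f ω) * ψ (g ω) ∂μ =
      (∫⁻ ω in f ⁻¹' S, φ (f ω) ∂μ) * ∫⁻ ω, ψ (g ω) ∂μ := by
  have h := lintegral_mul_eq_lintegral_mul_lintegral_of_indepFun
    ((hφ.indicator hS).comp hf) (hψ.comp hg) (hfg.comp (hφ.indicator hS) hψ)
  rw [← lintegral_indicator (hf hS), ← lintegral_indicator (hf hS)]
  convert h using 2
  · ext ω
    by_cases hω : f ω ∈ S
    · rw [Set.indicator_of_mem (show ω ∈ f ⁻¹' S from hω)]
      simp [hω]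
    · rw [Set.indicator_of_notMem (show ω ∉ f ⁻¹' S from hω)]
      simp [hω]
  · rfl
  · rfl

/-- With independent utilities and an eligible set that depends on `x` only, the adopted solution
is distributed like an eligible sample, conditionally on there being one. -/
lemma mul_setLIntegral_le_delegationValue {m : ℕ} {μ : Measure Ω} [IsProbabilityMeasure μ]
    {x y : Ω → ℝ} (hx : Measurable x) (hy : Measurable y) (hy0 : ∀ ω, 0 ≤ y ω)
    (hya : Atomless μ y) (hxy : IndepFun x y μ) {S : Set ℝ} (hS : MeasurableSet S)
    {σ : Strategy (singleProposal (x ⁻¹' S)) (m + 1)}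
    (hσ : IsBestResponse (singleProposal (x ⁻¹' S)) y σ) :
    (1 - μ (x ⁻¹' S)ᶜ ^ (m + 1)) * ∫⁻ ω in x ⁻¹' S, ENNReal.ofReal (x ω) ∂μ ≤
      μ (x ⁻¹' S) *
        delegationValue (fun _ : Fin (m + 1) => μ) x (singleProposal (x ⁻¹' S)) σ := by
  set R := x ⁻¹' S with hRdef
  have hR : MeasurableSet R := hx hS
  have hV := le_delegationValue μ hx hy hy0 hya hR hσ
  set H : ℝ → ℝ≥0∞ := fun v => μ {ω' | ω' ∈ R → y ω' < v} ^ m with hH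
  have hHm : Measurable H := by
    refine Monotone.measurable fun v w hvw => ?_
    refine pow_le_pow_left₀ zero_le (measure_mono fun ω h hω => ?_) m
    exact (h hω).trans_le hvw
  have h1 : ∫⁻ ω in R, ENNReal.ofReal (x ω) * μ {ω' | ω' ∈ R → y ω' < y ω} ^ m ∂μ =
      (∫⁻ ω in R, ENNReal.ofReal (x ω) ∂μ) * ∫⁻ ω, H (y ω) ∂μ :=
    setLIntegral_preimage_mul_of_indepFun hx hy hxy ENNReal.measurable_ofReal hHm hS
  have h2 : ∫⁻ ω in R, 1 * H (y ω) ∂μ = μ R * ∫⁻ ω, H (y ω) ∂μ := by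
    rw [setLIntegral_preimage_mul_of_indepFun hx hy hxy measurable_const hHm hS]
    simp [hRdef]
  -- Weak preference is used so that some eligible sample always qualifies when there is one; since
  -- y is atomless the sections have the same measure as the strict ones.
  set K : Set (Ω × Ω) := {p | p.2 ∈ R → y p.2 ≤ y p.1} with hK
  have hKm : MeasurableSet K := by
    have : K = (Prod.snd ⁻¹' R)ᶜ ∪ {p | y p.2 ≤ y p.1} := by
      ext p; simp only [hK, Set.mem_ofPred_eq, Set.mem_union, Set.mem_compl_iff, Set.mem_preimage]
      tauto
    rw [this]
    exact (hR.preimage measurable_snd).compl.union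
      (measurableSet_le (hy.comp measurable_snd) (hy.comp measurable_fst))
  have hweak : ∀ ω, μ (Prod.mk ω ⁻¹' K) = μ {ω' | ω' ∈ R → y ω' < y ω} := by
    intro ω
    refine measure_congr ?_
    have : ∀ᵐ ω' ∂μ, y ω' ≠ y ω := by
      rw [ae_iff]; simpa using hya (y ω)
    filter_upwards [this] with ω' h
    refine propext ⟨fun hh hr => lt_of_le_of_ne (hh hr) h, fun hh hr => (hh hr).le⟩
  have hterm : ∀ i : Fin (m + 1),
      ∫⁻ s in {s : Fin (m + 1) → Ω | ∀ j, j ≠ i → (s i, s j) ∈ K},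
        R.indicator 1 (s i) ∂(Measure.pi fun _ : Fin (m + 1) => μ) =
      μ R * ∫⁻ ω, H (y ω) ∂μ := by
    intro i
    rw [setLIntegral_pi_forall_ne (fun _ => μ) (measurable_one.indicator hR) hKm i, ← h2,
      ← lintegral_indicator hR]
    refine lintegral_congr fun ω => ?_
    simp only [hweak, Finset.prod_const, Finset.card_univ, Fintype.card_fin]
    by_cases hω : ω ∈ R <;> simp [hω, hH]
  -- Either no sample is eligible or some eligible one maximizes y. This bounds the integral of `H`
  -- from below, and by `h1` the same integral is a factor of the delegation value.
  have hcover : 1 ≤ μ Rᶜ ^ (m + 1) + (m + 1) * (μ R * ∫⁻ ω, H (y ω) ∂μ) := by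
    set N : Set (Fin (m + 1) → Ω) := Set.univ.pi fun _ => Rᶜ with hN
    have hNm : MeasurableSet N := MeasurableSet.univ_pi fun _ => hR.compl
    have hpiN : Measure.pi (fun _ : Fin (m + 1) => μ) N = μ Rᶜ ^ (m + 1) := by
      rw [hN, Measure.pi_pi]; simp
    have hsum : (m + 1 : ℝ≥0∞) * (μ R * ∫⁻ ω, H (y ω) ∂μ) = ∑ i : Fin (m + 1),
        ∫⁻ s in {s : Fin (m + 1) → Ω | ∀ j, j ≠ i → (s i, s j) ∈ K},
          R.indicator 1 (s i) ∂(Measure.pi fun _ : Fin (m + 1) => μ) := by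
      simp_rw [hterm]; simp
    rw [hsum, ← hpiN, ← lintegral_indicator_one hNm]
    simp_rw [← lintegral_indicator (measurableSet_forall_ne hKm _)]
    rw [← lintegral_finsetSum, ← lintegral_add_left]
    · have : (1 : ℝ≥0∞) = ∫⁻ _, 1 ∂(Measure.pi fun _ : Fin (m + 1) => μ) := by simp
      rw [this]
      refine lintegral_mono fun s => ?_
      by_cases hs : s ∈ N
      · rw [Set.indicator_of_mem hs]; exact le_self_add
      · obtain ⟨i₀, hi₀⟩ : ∃ i, s i ∈ R := by
          by_contra h
          push Not at h
          exact hs fun i _ => h i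
        classical
        obtain ⟨i, hi, hmax⟩ := Finset.exists_max_image
          (Finset.univ.filter fun i => s i ∈ R) (fun i => y (s i)) ⟨i₀, by simp [hi₀]⟩
        simp only [Finset.mem_filter, Finset.mem_univ, true_and] at hi hmax
        refine le_trans ?_ le_add_self
        refine le_trans ?_ (Finset.single_le_sum (fun _ _ => zero_le) (Finset.mem_univ i))
        rw [Set.indicator_of_mem]
        · simp [hi]
        · exact fun j _ hj => hmax j hj
    · exact measurable_one.indicator hNm
    · intro i _
      exact ((measurable_one.indicator hR).comp (measurable_pi_apply i)).indicator
        (measurableSet_forall_ne hKm i)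
  rw [h1] at hV
  calc (1 - μ Rᶜ ^ (m + 1)) * ∫⁻ ω in R, ENNReal.ofReal (x ω) ∂μ
      ≤ ((m + 1) * (μ R * ∫⁻ ω, H (y ω) ∂μ)) * ∫⁻ ω in R, ENNReal.ofReal (x ω) ∂μ := by
        gcongr
        exact tsub_le_iff_left.2 hcover
    _ = μ R * ((m + 1) * ((∫⁻ ω in R, ENNReal.ofReal (x ω) ∂μ) * ∫⁻ ω, H (y ω) ∂μ)) := by ring
    _ ≤ _ := by gcongr

/-- Without any restriction on the proposals, the principal gets at least the mean of `x`, if the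
utilities are independent. -/
lemma lintegral_le_delegationValue_univ {m : ℕ} {μ : Measure Ω} [IsProbabilityMeasure μ]
    {x y : Ω → ℝ} (hx : Measurable x) (hx0 : ∀ ω, 0 ≤ x ω) (hy : Measurable y)
    (hy0 : ∀ ω, 0 ≤ y ω) (hya : Atomless μ y) (hxy : IndepFun x y μ)
    {σ : Strategy (singleProposal (x ⁻¹' Set.Ici 0)) (m + 1)}
    (hσ : IsBestResponse (singleProposal (x ⁻¹' Set.Ici 0)) y σ) :
    ∫⁻ ω, ENNReal.ofReal (x ω) ∂μ ≤
      delegationValue (fun _ : Fin (m + 1) => μ) x (singleProposal (x ⁻¹' Set.Ici 0)) σ := by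
  have h := mul_setLIntegral_le_delegationValue hx hy hy0 hya hxy measurableSet_Ici hσ
  have hu : x ⁻¹' Set.Ici 0 = Set.univ := Set.eq_univ_of_forall hx0
  have e1 : μ (x ⁻¹' Set.Ici 0) = 1 := by rw [hu, measure_univ]
  have e2 : μ (x ⁻¹' Set.Ici 0)ᶜ = 0 := by rw [hu, Set.compl_univ, measure_empty]
  have e3 : ∫⁻ ω in x ⁻¹' Set.Ici 0, ENNReal.ofReal (x ω) ∂μ =
      ∫⁻ ω, ENNReal.ofReal (x ω) ∂μ := by rw [hu, setLIntegral_univ]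
  rw [e1, e2, e3] at h
  simpa using h

/-- A partial expectation is the expected excess plus the threshold times the tail probability. -/
lemma setLIntegral_Ioi_eq_excess_add {μ : Measure Ω} {x : Ω → ℝ} (hx : Measurable x) {θ : ℝ}
    (hθ : 0 ≤ θ) :
    ∫⁻ ω in x ⁻¹' Set.Ioi θ, ENNReal.ofReal (x ω) ∂μ =
      ∫⁻ ω, ENNReal.ofReal (x ω - θ) ∂μ + ENNReal.ofReal θ * μ (x ⁻¹' Set.Ioi θ) := by
  have hRm : MeasurableSet (x ⁻¹' Set.Ioi θ) := hx measurableSet_Ioi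
  have e : ∫⁻ ω, ENNReal.ofReal (x ω - θ) ∂μ =
      ∫⁻ ω in x ⁻¹' Set.Ioi θ, ENNReal.ofReal (x ω - θ) ∂μ := by
    rw [← lintegral_indicator hRm]
    refine lintegral_congr fun ω => ?_
    by_cases hω : ω ∈ x ⁻¹' Set.Ioi θ
    · rw [Set.indicator_of_mem hω]
    · rw [Set.indicator_of_notMem hω]
      have : ¬ θ < x ω := hω
      exact ENNReal.ofReal_of_nonpos (by linarith)
  rw [e, ← setLIntegral_const, ← lintegral_add_right _ measurable_const]
  refine setLIntegral_congr_fun hRm fun ω hω => ?_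
  have : θ < x ω := hω
  rw [← ENNReal.ofReal_add (by linarith) hθ]
  congr 1; ring

/-- A threshold on the principal's utility gives a `1 - 1/e` fraction of the value of searching
directly, if the utilities are independent and atomless. -/
theorem exists_threshold_one_sub_inv_exp {n : ℕ} (μ : Measure Ω) [IsProbabilityMeasure μ]
    {x : Ω → ℝ} (hn : 1 ≤ n) (hx : Measurable x) (hx0 : ∀ ω, 0 ≤ x ω) (hxa : Atomless μ x) :
    ∃ R : Set Ω, IsThresholdSet x R ∧ ∀ y : Ω → ℝ, Measurable y → (∀ ω, 0 ≤ y ω) →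
      Atomless μ y → IndepFun x y μ →
      ∀ σ : Strategy (singleProposal R) n, IsBestResponse (singleProposal R) y σ →
        ENNReal.ofReal (1 - 1 / Real.exp 1) * searchValue (fun _ : Fin n => μ) x ≤
          delegationValue (fun _ : Fin n => μ) x (singleProposal R) σ := by
  obtain ⟨m, rfl⟩ : ∃ m, n = m + 1 := ⟨n - 1, by omega⟩
  have hexp : ENNReal.ofReal (1 - 1 / Real.exp 1) ≤ 1 := by
    rw [ENNReal.ofReal_le_one]
    have := Real.exp_pos 1
    linarith [show 0 < 1 / Real.exp 1 by positivity]
  -- For n = 1 the quantile of order 1/n = 1 need not be attained; accepting everything already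
  -- gives the benchmark.
  rcases Nat.eq_zero_or_pos m with rfl | hm
  · refine ⟨x ⁻¹' Set.Ici 0, ⟨0, Or.inl rfl⟩, fun y hy hy0 hya hxy σ hσ => ?_⟩
    have h := lintegral_le_delegationValue_univ hx hx0 hy hy0 hya hxy hσ
    have hS := searchValue_le_add_sum (fun _ : Fin (0 + 1) => μ) hx 0
    refine le_trans (mul_le_of_le_one_left' hexp) (le_trans hS ?_)
    simpa using h
  · have hm' : (0 : ℝ) < m := by exact_mod_cast hm
    obtain ⟨θ, hθ⟩ := exists_measureReal_lt_eq hx hxa (t := 1 / (m + 1 : ℝ)) (by positivity)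
      (by rw [div_lt_one (by positivity)]; linarith)
    have hθ0 : 0 ≤ θ := by
      by_contra h
      have hu : {ω | θ < x ω} = Set.univ :=
        Set.eq_univ_of_forall fun ω => (not_le.1 h).trans_le (hx0 ω)
      rw [hu, probReal_univ, eq_div_iff (by positivity)] at hθ
      linarith
    obtain ⟨R, hR⟩ : ∃ R, R = x ⁻¹' Set.Ioi θ := ⟨_, rfl⟩
    refine ⟨R, ⟨θ, Or.inr hR⟩, fun y hy hy0 hya hxy σ hσ => ?_⟩
    have h : (1 - μ Rᶜ ^ (m + 1)) * ∫⁻ ω in R, ENNReal.ofReal (x ω) ∂μ ≤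
        μ R * delegationValue (fun _ : Fin (m + 1) => μ) x (singleProposal R) σ := by
      subst hR
      exact mul_setLIntegral_le_delegationValue hx hy hy0 hya hxy measurableSet_Ioi hσ
    have hRm : MeasurableSet R := hR ▸ hx measurableSet_Ioi
    have hq : μ R = ENNReal.ofReal (1 / (m + 1 : ℝ)) := by
      rw [← hθ, ofReal_measureReal, hR]; rfl
    have hnq : (m + 1 : ℝ≥0∞) * μ R = 1 := by
      rw [hq, show (m + 1 : ℝ≥0∞) = ENNReal.ofReal (m + 1 : ℝ) by
        rw [ENNReal.ofReal_add (by positivity) (by positivity)]; simp,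
        ← ENNReal.ofReal_mul (by positivity), mul_one_div_cancel (by positivity),
        ENNReal.ofReal_one]
    have hcompl : ENNReal.ofReal (1 - 1 / Real.exp 1) ≤ 1 - μ Rᶜ ^ (m + 1) := by
      rw [prob_compl_eq_one_sub hRm, hq, ← ENNReal.ofReal_one,
        ← ENNReal.ofReal_sub _ (by positivity), ← ENNReal.ofReal_pow, ← ENNReal.ofReal_sub]
      · refine ENNReal.ofReal_le_ofReal ?_
        have := Real.one_sub_div_pow_le_exp_neg (n := m + 1) (t := 1) (by push_cast; linarith)
        rw [Real.exp_neg, ← one_div] at this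
        push_cast at this
        linarith
      · exact pow_nonneg (by rw [sub_nonneg, div_le_one (by positivity)]; linarith) _
      · rw [sub_nonneg, div_le_one (by positivity)]; linarith
    have hint : ∫⁻ ω in R, ENNReal.ofReal (x ω) ∂μ =
        ∫⁻ ω, ENNReal.ofReal (x ω - θ) ∂μ + ENNReal.ofReal θ * μ R := by
      rw [hR, setLIntegral_Ioi_eq_excess_add hx hθ0]
    -- Since nq = 1, the single θ in the benchmark bound equals nθq, which completes the n excesses
    -- to n partial expectations.
    have hS : searchValue (fun _ : Fin (m + 1) => μ) x ≤
        (m + 1) * ∫⁻ ω in R, ENNReal.ofReal (x ω) ∂μ := by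
      refine (searchValue_le_add_sum (fun _ : Fin (m + 1) => μ) hx θ).trans ?_
      rw [hint, mul_add, mul_left_comm, hnq, mul_one, add_comm]
      simp
    calc ENNReal.ofReal (1 - 1 / Real.exp 1) * searchValue (fun _ : Fin (m + 1) => μ) x
        ≤ (1 - μ Rᶜ ^ (m + 1)) * ((m + 1) * ∫⁻ ω in R, ENNReal.ofReal (x ω) ∂μ) := by gcongr
      _ = (m + 1) * ((1 - μ Rᶜ ^ (m + 1)) * ∫⁻ ω in R, ENNReal.ofReal (x ω) ∂μ) := by ring
      _ ≤ (m + 1) * (μ R * delegationValue (fun _ : Fin (m + 1) => μ) x (singleProposal R) σ) := by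
        gcongr
      _ = delegationValue (fun _ : Fin (m + 1) => μ) x (singleProposal R) σ := by
        rw [← mul_assoc, hnq, one_mul]

/-! ### The equation for `α` and its numerical enclosure -/

lemma continuous_sub_mul_log : Continuous fun t : ℝ => t - t * Real.log t :=
  continuous_id.sub Real.continuous_mul_log

/-- The derivative is -log t ≥ 0. The proof uses log (b/a) ≤ b/a - 1 instead; at 0 the convention
log 0 = 0 gives the correct limit. -/
lemma monotoneOn_sub_mul_log : MonotoneOn (fun t : ℝ => t - t * Real.log t) (Set.Icc 0 1) := by
  intro a ha b hb hab
  dsimp only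
  rcases eq_or_lt_of_le ha.1 with rfl | ha0
  · have := mul_nonneg hb.1 (neg_nonneg.2 (Real.log_nonpos hb.1 hb.2))
    simp only [zero_mul, sub_zero]
    nlinarith [hb.1]
  · have hb0 := ha0.trans_le hab
    have h1 := Real.log_le_sub_one_of_pos (div_pos hb0 ha0)
    rw [Real.log_div hb0.ne' ha0.ne'] at h1
    have h2 : a * (Real.log b - Real.log a) ≤ b - a := by
      calc a * (Real.log b - Real.log a) ≤ a * (b / a - 1) := by gcongr
        _ = b - a := by field_simp
    nlinarith [mul_nonneg (sub_nonneg.2 hab) (neg_nonneg.2 (Real.log_nonpos hb.1 hb.2))]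

lemma sub_mul_log_nonneg {t : ℝ} (ht : t ∈ Set.Icc (0 : ℝ) 1) : 0 ≤ t - t * Real.log t := by
  have := monotoneOn_sub_mul_log (Set.left_mem_Icc.2 zero_le_one) ht ht.1
  simpa using this

lemma continuousOn_inv_sub_mul_log {b : ℝ} (hb : 1 < b) :
    ContinuousOn (fun t : ℝ => 1 / (t - t * Real.log t - 1 + b)) (Set.Icc 0 1) := by
  refine continuousOn_const.div
    ((continuous_sub_mul_log.sub continuous_const).add continuous_const).continuousOn ?_
  intro t ht
  have := sub_mul_log_nonneg ht
  linarith

lemma intervalIntegrable_inv_sub_mul_log {b u v : ℝ} (hb : 1 < b) (hu : 0 ≤ u) (huv : u ≤ v)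
    (hv : v ≤ 1) :
    IntervalIntegrable (fun t : ℝ => 1 / (t - t * Real.log t - 1 + b)) volume u v := by
  refine ((continuousOn_inv_sub_mul_log hb).mono ?_).intervalIntegrable
  rw [Set.uIcc_of_le huv]
  exact Set.Icc_subset_Icc hu hv

/-- The integral in the equation that defines the constant `α`, as a function of `b = 1 / α`. -/
noncomputable def hillKertz (b : ℝ) : ℝ :=
  ∫ t in (0 : ℝ)..1, 1 / (t - t * Real.log t - 1 + b)

lemma hillKertz_strictAnti {b b' : ℝ} (hb : 1 < b) (hbb : b < b') : hillKertz b' < hillKertz b := by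
  refine intervalIntegral.integral_lt_integral_of_continuousOn_of_le_of_exists_lt one_pos
    (continuousOn_inv_sub_mul_log (hb.trans hbb)) (continuousOn_inv_sub_mul_log hb) ?_ ?_
  · intro t ht
    have := sub_mul_log_nonneg (Set.Ioc_subset_Icc_self ht)
    exact one_div_le_one_div_of_le (by linarith) (by linarith)
  · refine ⟨0, by simp, ?_⟩
    have := sub_mul_log_nonneg (Set.left_mem_Icc.2 (zero_le_one' ℝ))
    exact one_div_lt_one_div_of_lt (by linarith) (by linarith)

/-- Truncating the denominator at 1/4 makes the integrand jointly continuous everywhere; for b ≥ 5/4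
the truncation is inactive. -/
lemma continuousOn_hillKertz : ContinuousOn hillKertz (Set.Icc (5 / 4) 2) := by
  have hc : Continuous fun b : ℝ => ∫ t in (0 : ℝ)..1,
      1 / max (t - t * Real.log t - 1 + b) (1 / 4) := by
    refine intervalIntegral.continuous_parametric_intervalIntegral_of_continuous' ?_ 0 1
    refine continuous_const.div ?_ ?_
    · exact ((((continuous_sub_mul_log.comp continuous_snd).sub continuous_const).add
        continuous_fst).max continuous_const)
    · intro p
      exact (lt_of_lt_of_le (by norm_num) (le_max_right _ _)).ne'
  refine hc.continuousOn.congr fun b hb => ?_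
  refine intervalIntegral.integral_congr fun t ht => ?_
  rw [Set.uIcc_of_le zero_le_one] at ht
  have := sub_mul_log_nonneg ht
  rw [max_eq_left]
  linarith [hb.1]

lemma integral_sub_mul_log {u v : ℝ} (hu : 0 ≤ u) (huv : u ≤ v) (c : ℝ) :
    ∫ t in u..v, (t - t * Real.log t + c) =
      (v ^ 2 * (3 / 4 - Real.log v / 2) + c * v) - (u ^ 2 * (3 / 4 - Real.log u / 2) + c * u) := by
  refine intervalIntegral.integral_eq_sub_of_hasDerivAt_of_le
    (f := fun t => t ^ 2 * (3 / 4 - Real.log t / 2) + c * t) huv ?_ (fun t ht => ?_) ?_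
  · have h : Continuous fun t : ℝ => 3 / 4 * t ^ 2 - t * (t * Real.log t) / 2 + c * t :=
      ((continuous_const.mul (continuous_pow 2)).sub
        ((continuous_id.mul Real.continuous_mul_log).div_const 2)).add
        (continuous_const.mul continuous_id)
    refine h.continuousOn.congr fun t _ => ?_
    ring
  · have ht0 : t ≠ 0 := (hu.trans_lt ht.1).ne'
    have h := ((hasDerivAt_pow 2 t).mul
      (((Real.hasDerivAt_log ht0).div_const 2).const_sub (3 / 4))).add
      ((hasDerivAt_id t).const_mul c)
    refine h.congr_deriv ?_
    field_simp
    push_cast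
    ring
  · exact (continuous_sub_mul_log.add continuous_const).intervalIntegrable _ _

/-- A piece of the integral is bounded above with the chord of `1 / D` on the range of the
denominator `D`. -/
lemma integral_inv_le_chord {u v c D₁ D₂ A : ℝ} (hc : 0 < c) (hu : 0 ≤ u) (huv : u ≤ v)
    (hv : v ≤ 1) (hD : 0 < D₁) (h1 : D₁ ≤ u - u * Real.log u + c)
    (h2 : v - v * Real.log v + c ≤ D₂) (hA : A ≤ ∫ t in u..v, (t - t * Real.log t + c)) :
    ∫ t in u..v, 1 / (t - t * Real.log t - 1 + (c + 1)) ≤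
      ((v - u) * (D₁ + D₂) - A) / (D₁ * D₂) := by
  have hmono : ∀ t ∈ Set.Icc u v, D₁ ≤ t - t * Real.log t + c ∧ t - t * Real.log t + c ≤ D₂ := by
    intro t ht
    have ht1 : t ∈ Set.Icc (0 : ℝ) 1 := ⟨hu.trans ht.1, ht.2.trans hv⟩
    have a1 := monotoneOn_sub_mul_log ⟨hu, huv.trans hv⟩ ht1 ht.1
    have a2 := monotoneOn_sub_mul_log ht1 ⟨hu.trans huv, hv⟩ ht.2
    dsimp only at a1 a2
    constructor <;> linarith
  have hD2 : 0 < D₂ := hD.trans_le ((hmono u ⟨le_rfl, huv⟩).1.trans (hmono u ⟨le_rfl, huv⟩).2)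
  have hcont : Continuous fun t : ℝ => t - t * Real.log t + c :=
    continuous_sub_mul_log.add continuous_const
  have hle : ∫ t in u..v, 1 / (t - t * Real.log t - 1 + (c + 1)) ≤
      ∫ t in u..v, ((D₁ + D₂) - (t - t * Real.log t + c)) / (D₁ * D₂) := by
    refine intervalIntegral.integral_mono_on huv
      (intervalIntegrable_inv_sub_mul_log (by linarith) hu huv hv)
      (((continuous_const.sub hcont).div_const _).intervalIntegrable _ _) fun t ht => ?_
    obtain ⟨a1, a2⟩ := hmono t ht
    rw [show t - t * Real.log t - 1 + (c + 1) = t - t * Real.log t + c by ring,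
      div_le_div_iff₀ (by linarith) (by positivity)]
    -- For D between D₁ and D₂, (D - D₁)(D₂ - D) ≥ 0 is the chord bound 1/D ≤ (D₁ + D₂ - D)/(D₁D₂).
    nlinarith [mul_nonneg (sub_nonneg.2 a1) (sub_nonneg.2 a2)]
  refine hle.trans ?_
  rw [intervalIntegral.integral_div, intervalIntegral.integral_sub
    (continuous_const.intervalIntegrable _ _) (hcont.intervalIntegrable _ _),
    intervalIntegral.integral_const, smul_eq_mul]
  gcongr

/-- A piece of the integral is bounded below by Jensen's inequality for `1 / D`. -/
lemma le_integral_inv_of_integral_le {u v c A : ℝ} (hc : 0 < c) (hu : 0 ≤ u) (huv : u < v)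
    (hv : v ≤ 1) (hA : ∫ t in u..v, (t - t * Real.log t + c) ≤ A) :
    (v - u) ^ 2 / A ≤ ∫ t in u..v, 1 / (t - t * Real.log t - 1 + (c + 1)) := by
  have hcont : Continuous fun t : ℝ => t - t * Real.log t + c :=
    continuous_sub_mul_log.add continuous_const
  have hpos : ∀ t ∈ Set.Icc u v, 0 < t - t * Real.log t + c := fun t ht => by
    have := sub_mul_log_nonneg (⟨hu.trans ht.1, ht.2.trans hv⟩ : t ∈ Set.Icc (0 : ℝ) 1)
    linarith
  have hA0 : 0 < A := by
    refine lt_of_lt_of_le ?_ hA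
    exact intervalIntegral.intervalIntegral_pos_of_pos_on (hcont.intervalIntegrable _ _)
      (fun t ht => hpos t (Set.Ioo_subset_Icc_self ht)) huv
  -- The tangent bound 1/D ≥ 2k - k²D holds for every k; this k is optimal when A is the integral of
  -- D.
  set k := (v - u) / A with hk
  have hle : ∫ t in u..v, (2 * k - k ^ 2 * (t - t * Real.log t + c)) ≤
      ∫ t in u..v, 1 / (t - t * Real.log t - 1 + (c + 1)) := by
    refine intervalIntegral.integral_mono_on huv.le
      ((continuous_const.sub (continuous_const.mul hcont)).intervalIntegrable _ _)
      (intervalIntegrable_inv_sub_mul_log (by linarith) hu huv.le hv) fun t ht => ?_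
    have h := hpos t ht
    rw [show t - t * Real.log t - 1 + (c + 1) = t - t * Real.log t + c by ring, le_div_iff₀ h]
    nlinarith [sq_nonneg (k * (t - t * Real.log t + c) - 1)]
  refine le_trans ?_ hle
  have hcont' : Continuous fun t : ℝ => k ^ 2 * (t - t * Real.log t + c) :=
    continuous_const.mul hcont
  rw [intervalIntegral.integral_sub (continuous_const.intervalIntegrable _ _)
    (hcont'.intervalIntegrable _ _), intervalIntegral.integral_const,
    intervalIntegral.integral_const_mul, smul_eq_mul]
  have : (v - u) ^ 2 / A = (v - u) * (2 * k) - k ^ 2 * A := by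
    rw [hk]; field_simp; ring
  rw [this]
  gcongr

/-- The grid consists of powers of 4/5, so log (5/4) is the only logarithm to be enclosed. -/
lemma log_five_fourths_bounds :
    0.22314355 ≤ Real.log (5 / 4) ∧ Real.log (5 / 4) ≤ 0.22314356 := by
  have h4 : Real.log 4 = 2 * Real.log 2 := Real.log_four_eq
  rw [Real.log_div (by norm_num) (by norm_num), h4]
  have := Real.log_five_gt_d9
  have := Real.log_five_lt_d9
  have := Real.log_two_gt_d9
  have := Real.log_two_lt_d9
  constructor <;> linarith

lemma log_four_fifths_pow (i : ℕ) : Real.log ((4 / 5) ^ i) = -(i * Real.log (5 / 4)) := by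
  rw [Real.log_pow, show (4 / 5 : ℝ) = (5 / 4)⁻¹ by norm_num, Real.log_inv]
  ring

lemma four_fifths_pow_mem (i : ℕ) : 0 < (4 / 5 : ℝ) ^ i ∧ (4 / 5 : ℝ) ^ i ≤ 1 :=
  ⟨by positivity, pow_le_one₀ (by norm_num) (by norm_num)⟩

lemma four_fifths_pow_succ_lt (i : ℕ) : (4 / 5 : ℝ) ^ (i + 1) < (4 / 5) ^ i := by
  rw [pow_succ]
  linarith [(four_fifths_pow_mem i).1]

lemma hillKertz_integral_split {c : ℝ} (hc : 0 < c) {u v : ℝ} (hu : 0 ≤ u) (huv : u ≤ v)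
    (hv : v ≤ 1) :
    ∫ t in u..1, 1 / (t - t * Real.log t - 1 + (c + 1)) =
      (∫ t in v..1, 1 / (t - t * Real.log t - 1 + (c + 1))) +
        ∫ t in u..v, 1 / (t - t * Real.log t - 1 + (c + 1)) := by
  exact (intervalIntegral.integral_add_adjacent_intervals
    (intervalIntegrable_inv_sub_mul_log (b := c + 1) (by linarith) hu huv hv)
    (intervalIntegrable_inv_sub_mul_log (b := c + 1) (by linarith) (hu.trans huv) hv le_rfl)).symm.trans
    (add_comm _ _)

/-- Upper bound for the part of the integral over `[(4/5)^k, 1]`, with geometric nodes. -/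
lemma integral_geometric_le {c a b : ℝ} (hc : 0 < c) (ha : 0 ≤ a) (hal : a ≤ Real.log (5 / 4))
    (hbl : Real.log (5 / 4) ≤ b) (k : ℕ) :
    ∫ t in ((4 / 5 : ℝ) ^ k)..1, 1 / (t - t * Real.log t - 1 + (c + 1)) ≤
      ∑ i ∈ Finset.range k, (((4 / 5) ^ i - (4 / 5) ^ (i + 1)) *
          (((4 / 5) ^ (i + 1) * (1 + (i + 1) * a) + c) + ((4 / 5) ^ i * (1 + i * b) + c)) -
        ((((4 / 5) ^ i) ^ 2 * (3 / 4 + i * a / 2) + c * (4 / 5) ^ i) -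
          (((4 / 5) ^ (i + 1)) ^ 2 * (3 / 4 + (i + 1) * b / 2) + c * (4 / 5) ^ (i + 1)))) /
        (((4 / 5) ^ (i + 1) * (1 + (i + 1) * a) + c) * ((4 / 5) ^ i * (1 + i * b) + c)) := by
  induction k with
  | zero => simp
  | succ i ih =>
    obtain ⟨h0, h1⟩ := four_fifths_pow_mem i
    obtain ⟨h0', h1'⟩ := four_fifths_pow_mem (i + 1)
    have hlt := four_fifths_pow_succ_lt i
    rw [Finset.sum_range_succ, hillKertz_integral_split hc h0'.le hlt.le h1]
    refine add_le_add ih (integral_inv_le_chord hc h0'.le hlt.le h1 (by positivity) ?_ ?_ ?_)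
    · rw [log_four_fifths_pow]
      have : (4 / 5 : ℝ) ^ (i + 1) * ((i + 1) * a) ≤
          (4 / 5 : ℝ) ^ (i + 1) * ((i + 1) * Real.log (5 / 4)) := by gcongr
      push_cast
      linarith
    · rw [log_four_fifths_pow]
      have : (4 / 5 : ℝ) ^ i * (i * Real.log (5 / 4)) ≤ (4 / 5 : ℝ) ^ i * (i * b) := by gcongr
      linarith
    · rw [integral_sub_mul_log h0'.le hlt.le, log_four_fifths_pow, log_four_fifths_pow]
      have e1 : ((4 / 5 : ℝ) ^ i) ^ 2 * (i * a) ≤ ((4 / 5 : ℝ) ^ i) ^ 2 * (i * Real.log (5 / 4)) := by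
        gcongr
      have e2 : ((4 / 5 : ℝ) ^ (i + 1)) ^ 2 * ((i + 1) * Real.log (5 / 4)) ≤
          ((4 / 5 : ℝ) ^ (i + 1)) ^ 2 * ((i + 1) * b) := by gcongr
      push_cast
      linarith

/-- Lower bound for the part of the integral over `[(4/5)^k, 1]`, with geometric nodes. -/
lemma le_integral_geometric {c a b : ℝ} (hc : 0 < c) (hal : a ≤ Real.log (5 / 4))
    (hbl : Real.log (5 / 4) ≤ b) (k : ℕ) :
    ∑ i ∈ Finset.range k, ((4 / 5) ^ i - (4 / 5) ^ (i + 1)) ^ 2 /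
        ((((4 / 5) ^ i) ^ 2 * (3 / 4 + i * b / 2) + c * (4 / 5) ^ i) -
          (((4 / 5) ^ (i + 1)) ^ 2 * (3 / 4 + (i + 1) * a / 2) + c * (4 / 5) ^ (i + 1))) ≤
      ∫ t in ((4 / 5 : ℝ) ^ k)..1, 1 / (t - t * Real.log t - 1 + (c + 1)) := by
  induction k with
  | zero => simp
  | succ i ih =>
    obtain ⟨h0, h1⟩ := four_fifths_pow_mem i
    obtain ⟨h0', h1'⟩ := four_fifths_pow_mem (i + 1)
    have hlt := four_fifths_pow_succ_lt i
    rw [Finset.sum_range_succ, hillKertz_integral_split hc h0'.le hlt.le h1]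
    refine add_le_add ih (le_integral_inv_of_integral_le hc h0'.le hlt h1 ?_)
    rw [integral_sub_mul_log h0'.le hlt.le, log_four_fifths_pow, log_four_fifths_pow]
    have e1 : ((4 / 5 : ℝ) ^ i) ^ 2 * (i * Real.log (5 / 4)) ≤ ((4 / 5 : ℝ) ^ i) ^ 2 * (i * b) := by
      gcongr
    have e2 : ((4 / 5 : ℝ) ^ (i + 1)) ^ 2 * ((i + 1) * a) ≤
        ((4 / 5 : ℝ) ^ (i + 1)) ^ 2 * ((i + 1) * Real.log (5 / 4)) := by gcongr
    push_cast
    linarith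

-- Here 51/149 = 1/0.745 - 1. The piece next to 0 is one more chord, the denominator at 0 being
-- exactly 51/149.
set_option maxRecDepth 20000 in
lemma hillKertz_upper_lt_one : hillKertz (1 / 0.745) < 1 := by
  obtain ⟨hL1, hL2⟩ := log_five_fourths_bounds
  have hc : (0 : ℝ) < 51 / 149 := by norm_num
  obtain ⟨h0, h1⟩ := four_fifths_pow_mem 24
  have hmain := integral_geometric_le hc (by norm_num) hL1 hL2 24
  have hlast : ∫ t in (0 : ℝ)..(4 / 5) ^ 24, 1 / (t - t * Real.log t - 1 + (51 / 149 + 1)) ≤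
      (((4 / 5) ^ 24 - 0) * (51 / 149 + ((4 / 5) ^ 24 * (1 + 24 * 0.22314356) + 51 / 149)) -
        (((4 / 5) ^ 24) ^ 2 * (3 / 4 + 24 * 0.22314355 / 2) + 51 / 149 * (4 / 5) ^ 24)) /
        (51 / 149 * ((4 / 5) ^ 24 * (1 + 24 * 0.22314356) + 51 / 149)) := by
    refine integral_inv_le_chord hc le_rfl h0.le h1 hc (by simp) ?_ ?_
    · rw [log_four_fifths_pow]
      have : (4 / 5 : ℝ) ^ 24 * (24 * Real.log (5 / 4)) ≤ (4 / 5 : ℝ) ^ 24 * (24 * 0.22314356) := by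
        gcongr
      push_cast
      linarith
    · rw [integral_sub_mul_log le_rfl h0.le, log_four_fifths_pow]
      have : ((4 / 5 : ℝ) ^ 24) ^ 2 * (24 * 0.22314355) ≤
          ((4 / 5 : ℝ) ^ 24) ^ 2 * (24 * Real.log (5 / 4)) := by gcongr
      push_cast
      linarith
  have hsplit := hillKertz_integral_split hc le_rfl h0.le h1
  rw [show (1 / 0.745 : ℝ) = 51 / 149 + 1 by norm_num, hillKertz, hsplit]
  refine (add_le_add hmain hlast).trans_lt ?_
  norm_num [Finset.sum_range_succ]

set_option maxRecDepth 20000 in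
lemma one_lt_hillKertz_lower : 1 < hillKertz (1 / 0.746) := by
  obtain ⟨hL1, hL2⟩ := log_five_fourths_bounds
  have hc : (0 : ℝ) < 127 / 373 := by norm_num
  obtain ⟨h0, h1⟩ := four_fifths_pow_mem 20
  have hmain := le_integral_geometric hc hL1 hL2 20
  have hlast : ((4 / 5) ^ 20 - 0) ^ 2 /
      (((4 / 5) ^ 20) ^ 2 * (3 / 4 + 20 * 0.22314356 / 2) + 127 / 373 * (4 / 5) ^ 20) ≤
      ∫ t in (0 : ℝ)..(4 / 5) ^ 20, 1 / (t - t * Real.log t - 1 + (127 / 373 + 1)) := by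
    refine le_integral_inv_of_integral_le hc le_rfl h0 h1 ?_
    rw [integral_sub_mul_log le_rfl h0.le, log_four_fifths_pow]
    have : ((4 / 5 : ℝ) ^ 20) ^ 2 * (20 * Real.log (5 / 4)) ≤
        ((4 / 5 : ℝ) ^ 20) ^ 2 * (20 * 0.22314356) := by gcongr
    push_cast
    linarith
  have hsplit := hillKertz_integral_split hc le_rfl h0.le h1
  rw [show (1 / 0.746 : ℝ) = 127 / 373 + 1 by norm_num, hillKertz, hsplit]
  refine lt_of_lt_of_le ?_ (add_le_add hmain hlast)
  norm_num [Finset.sum_range_succ]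

/-- The constant `α ≈ 0.7454`, as the unique solution of its equation. -/
lemma exists_unique_hillKertz_eq_one :
    ∃ α : ℝ, 0.745 < α ∧ α < 0.746 ∧ hillKertz (1 / α) = 1 ∧
      ∀ a : ℝ, 0 < a → a < 1 → (hillKertz (1 / a) = 1 ↔ a = α) := by
  have hsub : Set.Icc (1 / 0.746 : ℝ) (1 / 0.745) ⊆ Set.Icc (5 / 4) 2 :=
    Set.Icc_subset_Icc (by norm_num) (by norm_num)
  obtain ⟨b, ⟨hb1, hb2⟩, hb⟩ := intermediate_value_Ioo' (by norm_num)
    (continuousOn_hillKertz.mono hsub) (⟨hillKertz_upper_lt_one, one_lt_hillKertz_lower⟩ :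
      (1 : ℝ) ∈ Set.Ioo (hillKertz (1 / 0.745)) (hillKertz (1 / 0.746)))
  have hb0 : 0 < b := lt_trans (by norm_num) hb1
  refine ⟨1 / b, ?_, ?_, by rwa [one_div_one_div], fun a ha ha1 => ⟨fun h => ?_, fun h => ?_⟩⟩
  · rwa [lt_one_div (by norm_num) hb0]
  · rwa [one_div_lt hb0 (by norm_num)]
  · have hinv : 1 < 1 / a := by rwa [lt_div_iff₀ ha, one_mul]
    have hb1' : 1 < b := lt_trans (by norm_num) hb1
    rcases lt_trichotomy (1 / a) b with hlt | heq | hgt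
    · exact absurd (hillKertz_strictAnti hinv hlt) (by rw [h, hb]; exact lt_irrefl _)
    · rw [← heq, one_div_one_div]
    · exact absurd (hillKertz_strictAnti hb1' hgt) (by rw [h, hb]; exact lt_irrefl _)
  · rw [h, one_div_one_div, hb]

/-! ### Power and exponential inequalities -/

/-- The convex function z^(m+1) lies above its tangent at w. This one inequality drives the survival
bound, both discretizations and the convexity of the positive-part power. -/
lemma succ_mul_mul_pow_le {v w : ℝ} (hv : 0 ≤ v) (hw : 0 ≤ w) (m : ℕ) :
    (m + 1 : ℝ) * (v * w ^ m) ≤ v ^ (m + 1) + m * w ^ (m + 1) := by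
  rcases eq_or_lt_of_le hw with rfl | hw
  · rcases Nat.eq_zero_or_pos m with rfl | hm
    · simp
    · simp only [zero_pow hm.ne', zero_pow (Nat.succ_ne_zero m)]
      simp only [mul_zero, add_zero]
      positivity
  · have h := one_add_mul_le_pow (a := v / w - 1)
      (by linarith [show 0 ≤ v / w by positivity]) (m + 1)
    have h2 := mul_le_mul_of_nonneg_right h (by positivity : 0 ≤ w ^ (m + 1))
    rw [add_sub_cancel, div_pow, div_mul_cancel₀ _ (by positivity)] at h2
    have h3 : (1 + ((m + 1 : ℕ) : ℝ) * (v / w - 1)) * w ^ (m + 1) =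
        (m + 1) * (v * w ^ m) - m * w ^ (m + 1) := by
      push_cast
      field_simp
      ring
    linarith

lemma pow_sub_pow_le_mul {v w : ℝ} (hw : 0 ≤ w) (hwv : w ≤ v) (hv : v ≤ 1) (m : ℕ) :
    v ^ m - w ^ m ≤ m * (v - w) := by
  induction m with
  | zero => simp
  | succ m ih =>
    have h1 : v ^ (m + 1) - w ^ (m + 1) = v * (v ^ m - w ^ m) + w ^ m * (v - w) := by ring
    have h2 : v * (v ^ m - w ^ m) ≤ 1 * (v ^ m - w ^ m) :=
      mul_le_mul_of_nonneg_right hv (sub_nonneg.2 (pow_le_pow_left₀ hw hwv m))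
    have h3 : w ^ m * (v - w) ≤ 1 * (v - w) :=
      mul_le_mul_of_nonneg_right (pow_le_one₀ hw (hwv.trans hv)) (sub_nonneg.2 hwv)
    push_cast
    linarith

/-- Because (1 - t + t²/2)(1 + t + t²/2) = 1 + t⁴/4 ≥ 1, and the second factor is at most exp t. -/
lemma exp_neg_le_quadratic {t : ℝ} (ht : 0 ≤ t) : Real.exp (-t) ≤ 1 - t + t ^ 2 / 2 := by
  have h := Real.quadratic_le_exp_of_nonneg ht
  have h1 : Real.exp (-t) * Real.exp t = 1 := by rw [← Real.exp_add]; simp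
  have h2 : 0 < Real.exp (-t) := Real.exp_pos _
  nlinarith [sq_nonneg (t ^ 2), sq_nonneg (t - 1)]

/-- Comparison of the finite-sample kernel with its limit. -/
lemma sub_mul_log_pow_le {m : ℕ} (hm : 1 ≤ m) {v : ℝ} (hv0 : 0 < v) (hv1 : v ≤ 1) :
    v ^ m - v ^ m * Real.log (v ^ m) - 1 / m ≤ (m + 1) * v ^ m - m * v ^ (m + 1) := by
  have hm' : (0 : ℝ) < m := by exact_mod_cast hm
  obtain ⟨t, rfl⟩ : ∃ t, v = Real.exp (-t) := ⟨-Real.log v, by rw [neg_neg, Real.exp_log hv0]⟩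
  have ht : 0 ≤ t := by
    have := Real.exp_le_one_iff.1 hv1
    linarith
  have h1 := exp_neg_le_quadratic ht
  have h2 := Real.quadratic_le_exp_of_nonneg (show 0 ≤ m * t by positivity)
  have hs : Real.exp (-t) ^ m = Real.exp (-(m * t)) := by rw [← Real.exp_nat_mul]; ring_nf
  have h3 : Real.exp (-(m * t)) * Real.exp (m * t) = 1 := by rw [← Real.exp_add]; simp
  have h4 : 0 < Real.exp (-(m * t)) := Real.exp_pos _
  rw [pow_succ, hs, Real.log_exp]
  have h5 : Real.exp (-(m * t)) * ((m * t) ^ 2 / 2) ≤ 1 := by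
    rw [← h3]
    exact mul_le_mul_of_nonneg_left (by nlinarith [mul_nonneg hm'.le ht]) h4.le
  -- With v = exp(-t) and s = v^m the two kernels differ by s·m·(t - 1 + exp(-t)) ≤ s (mt)²/(2m),
  -- and s (mt)²/2 ≤ 1.
  have h6 : Real.exp (-(m * t)) * m * (t - 1 + Real.exp (-t)) ≤ 1 / m := by
    rw [le_div_iff₀ hm']
    calc Real.exp (-(m * t)) * m * (t - 1 + Real.exp (-t)) * m
        ≤ Real.exp (-(m * t)) * m * (t ^ 2 / 2) * m := by gcongr; linarith
      _ = Real.exp (-(m * t)) * ((m * t) ^ 2 / 2) := by ring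
      _ ≤ 1 := h5
  nlinarith

/-! ### The schedule of quantiles -/

/-- Survival probabilities under a control `u` when cell `i` lasts for `c * w i / P i ^ m`. -/
noncomputable def survival (c : ℝ) (m : ℕ) (w u : ℕ → ℝ) : ℕ → ℝ
  | 0 => 1
  | i + 1 => survival c m w u i - c * w i / survival c m w u i ^ m * u i

/-- A step d = c w u / p^m satisfies (p - d)^(m+1) ≥ p^(m+1) - (m+1) p^m d by convexity, and p^m
cancels: the (m+1)-st power decreases at most linearly. The margin `κ` keeps the survival
probability positive, and `hcw` prevents a step from overshooting 0. -/
lemma survival_bounds {c κ : ℝ} {m N : ℕ} {w u : ℕ → ℝ} (hc : 0 ≤ c) (hκ : 0 < κ)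
    (hw : ∀ i < N, 0 ≤ w i) (hu : ∀ i < N, 0 ≤ u i ∧ u i ≤ 1)
    (hY : ∀ i ≤ N, κ ≤ 1 - c * ((m + 1) * ∑ j ∈ Finset.range i, w j * u j))
    (hcw : ∀ i < N, c * w i ≤ κ) :
    ∀ i ≤ N, 0 < survival c m w u i ∧ survival c m w u i ≤ 1 ∧
      1 - c * ((m + 1) * ∑ j ∈ Finset.range i, w j * u j) ≤ survival c m w u i ^ (m + 1) := by
  intro i
  induction i with
  | zero => intro _; simp [survival]
  | succ i ih =>
    intro hi
    obtain ⟨h0, h1, h2⟩ := ih (by omega)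
    have hwi := hw i hi
    obtain ⟨hu0, hu1⟩ := hu i hi
    set p := survival c m w u i with hp
    have hstep : survival c m w u (i + 1) = p - c * w i / p ^ m * u i := rfl
    rw [hstep]
    have hd0 : 0 ≤ c * w i / p ^ m * u i := by positivity
    have hd1 : c * w i / p ^ m * u i ≤ p := by
      have : c * w i / p ^ m ≤ p := by
        rw [div_le_iff₀ (by positivity), ← pow_succ']
        exact (hcw i hi).trans ((hY i (by omega)).trans h2)
      calc c * w i / p ^ m * u i ≤ c * w i / p ^ m * 1 := by gcongr
        _ ≤ p := by linarith
    have hpow : 1 - c * ((m + 1) * ∑ j ∈ Finset.range (i + 1), w j * u j) ≤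
        (p - c * w i / p ^ m * u i) ^ (m + 1) := by
      have hb := succ_mul_mul_pow_le (sub_nonneg.2 hd1) h0.le m
      have e : (m + 1 : ℝ) * ((p - c * w i / p ^ m * u i) * p ^ m) =
          (m + 1) * p ^ (m + 1) - (m + 1) * (c * w i * u i) := by
        field_simp
        ring
      rw [Finset.sum_range_succ]
      rw [e] at hb
      linarith
    refine ⟨?_, by linarith, hpow⟩
    refine lt_of_le_of_ne (sub_nonneg.2 hd1) fun h => ?_
    have := hY (i + 1) hi
    rw [← h, zero_pow (Nat.succ_ne_zero m)] at hpow
    linarith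

lemma one_sub_sum_eq_survival (c : ℝ) (m : ℕ) (w u : ℕ → ℝ) (i : ℕ) :
    1 - ∑ j ∈ Finset.range i, c * w j / survival c m w u j ^ m * u j = survival c m w u i := by
  induction i with
  | zero => simp [survival]
  | succ i ih => rw [Finset.sum_range_succ, survival, ← ih]; ring

/-- The mass that the law of the maximum puts on the `i`-th of `N` cells of quantiles. -/
noncomputable def cellWeight (N m : ℕ) (i : ℕ) : ℝ :=
  (1 - (i : ℝ) / N) ^ m - (1 - ((i : ℝ) + 1) / N) ^ m

section
variable {N m : ℕ}

lemma node_bounds (hN : 0 < N) {i : ℕ} (hi : i ≤ N) :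
    0 ≤ 1 - (i : ℝ) / N ∧ 1 - (i : ℝ) / N ≤ 1 := by
  have hN' : (0 : ℝ) < N := by exact_mod_cast hN
  have hi' : (i : ℝ) ≤ N := by exact_mod_cast hi
  constructor
  · rw [sub_nonneg, div_le_one hN']; exact hi'
  · linarith [show 0 ≤ (i : ℝ) / N by positivity]

lemma node_succ_bounds (hN : 0 < N) {i : ℕ} (hi : i < N) :
    0 ≤ 1 - ((i : ℝ) + 1) / N ∧ 1 - ((i : ℝ) + 1) / N ≤ 1 - (i : ℝ) / N := by
  have hN' : (0 : ℝ) < N := by exact_mod_cast hN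
  have h := (node_bounds hN (i := i + 1) hi).1
  push_cast at h
  refine ⟨h, ?_⟩
  rw [add_div]
  linarith [show 0 < 1 / (N : ℝ) by positivity]

lemma cellWeight_nonneg (hN : 0 < N) {i : ℕ} (hi : i < N) : 0 ≤ cellWeight N m i :=
  sub_nonneg.2 (pow_le_pow_left₀ (node_succ_bounds hN hi).1 (node_succ_bounds hN hi).2 m)

lemma cellWeight_le (hN : 0 < N) {i : ℕ} (hi : i < N) : cellWeight N m i ≤ m / N := by
  have h := node_succ_bounds hN hi
  refine (pow_sub_pow_le_mul h.1 h.2 (node_bounds hN hi.le).2 m).trans (le_of_eq ?_)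
  ring

/-- With v = 1 - u, the integral of (m+1) m (1 - t)^(m-1) t over [0, u] is 1 - (m+1) v^m + m
v^(m+1). The last term pays for evaluating t at the right end of each cell. -/
lemma mul_sum_cellWeight_le (hN : 0 < N) {i : ℕ} (hi : i ≤ N) :
    (m + 1 : ℝ) * ∑ j ∈ Finset.range i, cellWeight N m j * (((j : ℝ) + 1) / N) ≤
      1 - (m + 1) * (1 - (i : ℝ) / N) ^ m + m * (1 - (i : ℝ) / N) ^ (m + 1) +
        (m + 1) / N * (1 - (1 - (i : ℝ) / N) ^ m) := by
  induction i with
  | zero => simp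
  | succ i ih =>
    have ih := ih (by omega)
    have h := node_succ_bounds hN hi
    have hv := (node_bounds hN (i := i) (by omega)).1
    have hy := succ_mul_mul_pow_le hv h.1 m
    rw [Finset.sum_range_succ, mul_add]
    push_cast
    unfold cellWeight at ih ⊢
    have e : ((i : ℝ) + 1) / N = 1 - (1 - (i : ℝ) / N) + 1 / N := by ring
    have e2 : ((i : ℝ) + 1) / N = 1 - (1 - ((i : ℝ) + 1) / N) := by ring
    generalize hw : 1 - ((i : ℝ) + 1) / N = w at *
    generalize hv' : 1 - (i : ℝ) / N = v at *
    generalize ∑ j ∈ Finset.range i, ((1 - (j : ℝ) / N) ^ m - (1 - ((j : ℝ) + 1) / N) ^ m) *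
      (((j : ℝ) + 1) / N) = S at *
    rw [e]
    have e3 : (m + 1 : ℝ) * ((v ^ m - w ^ m) * (1 - v + 1 / N)) =
        (m + 1) * (v ^ m - w ^ m) - (m + 1) * v ^ (m + 1) + (m + 1) * (v * w ^ m)
          + (m + 1) / N * (v ^ m - w ^ m) := by ring
    rw [e3]
    linarith

/-- The time budget: a sum over cells is a lower sum of the integral that defines `α`. -/
lemma sum_cellWeight_div_le (hN : 0 < N) {b : ℝ} (hb : 1 < b) {k : ℕ} (hk : k ≤ N) :
    ∑ i ∈ Finset.range k, cellWeight N m i / ((1 - (i : ℝ) / N) ^ m -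
        (1 - (i : ℝ) / N) ^ m * Real.log ((1 - (i : ℝ) / N) ^ m) - 1 + b) ≤
      ∫ t in ((1 - (k : ℝ) / N) ^ m)..1, 1 / (t - t * Real.log t - 1 + b) := by
  induction k with
  | zero => simp
  | succ k ih =>
    have ih := ih (by omega)
    have h := node_succ_bounds hN hk
    have hb' := node_bounds hN (i := k) (by omega)
    rw [Finset.sum_range_succ]
    push_cast
    unfold cellWeight at ih ⊢
    have hs1 : (1 - (k : ℝ) / N) ^ m ≤ 1 := pow_le_one₀ hb'.1 hb'.2
    have hs2 : (1 - ((k : ℝ) + 1) / N) ^ m ≤ (1 - (k : ℝ) / N) ^ m :=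
      pow_le_pow_left₀ h.1 h.2 m
    have hs3 : 0 ≤ (1 - ((k : ℝ) + 1) / N) ^ m := pow_nonneg h.1 m
    have hs4 : 0 ≤ (1 - (k : ℝ) / N) ^ m := pow_nonneg hb'.1 m
    generalize (1 - ((k : ℝ) + 1) / N) ^ m = s' at *
    generalize (1 - (k : ℝ) / N) ^ m = s at *
    have hi1 := intervalIntegrable_inv_sub_mul_log hb hs3 hs2 hs1
    have hi2 := intervalIntegrable_inv_sub_mul_log hb hs4 hs1 le_rfl
    rw [← intervalIntegral.integral_add_adjacent_intervals hi1 hi2, add_comm]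
    refine add_le_add ?_ ih
    have : (s - s') / (s - s * Real.log s - 1 + b) =
        ∫ _ in s'..s, 1 / (s - s * Real.log s - 1 + b) := by
      rw [intervalIntegral.integral_const, smul_eq_mul]; ring
    rw [this]
    refine intervalIntegral.integral_mono_on hs2 (continuous_const.intervalIntegrable _ _) hi1
      fun t ht => ?_
    have ht1 : t ∈ Set.Icc (0 : ℝ) 1 := ⟨hs3.trans ht.1, ht.2.trans hs1⟩
    have hf := monotoneOn_sub_mul_log ht1 ⟨hs4, hs1⟩ ht.2
    have hf0 := sub_mul_log_nonneg ht1
    dsimp only at hf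
    exact one_div_le_one_div_of_le (by linarith) (by linarith)

end

set_option maxHeartbeats 1000000 in
/-- A schedule of quantiles, each to be used for a given time, that collects an `α - O(1/n)`
fraction of the mass of every cell. -/
lemma exists_schedule {α : ℝ} (h1 : 0.745 < α) (h2 : α < 0.746) (hα : hillKertz (1 / α) = 1)
    {m : ℕ} (hm : 1 ≤ m) :
    ∃ (N : ℕ) (δ : ℕ → ℝ) (e : ℝ), 0 < N ∧ (∀ i < N, 0 ≤ δ i ∧ δ i ≤ e) ∧
      ∑ i ∈ Finset.range N, δ i ≤ 1 ∧ ∀ i < N, (α - 4 / (m + 1)) * cellWeight N m i ≤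
        δ i * max 0 (1 - e - ∑ j ∈ Finset.range i, δ j * (((j : ℝ) + 1) / N)) ^ m := by
  have hm0 : (1 : ℝ) ≤ m := by exact_mod_cast hm
  -- The cubic size gives m·(3m/N)·10 ≤ 1/(m+1), which bounds the discretization loss after the m-th
  -- power is taken.
  obtain ⟨N, hNdef⟩ : ∃ N : ℕ, N = 30 * (m + 1) ^ 3 := ⟨_, rfl⟩
  have hN : 0 < N := by rw [hNdef]; positivity
  have hN' : (0 : ℝ) < N := by exact_mod_cast hN
  have hNr : (N : ℝ) = 30 * (m + 1) ^ 3 := by rw [hNdef]; push_cast; ring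
  obtain ⟨b, hb⟩ : ∃ b, b = 1 / α := ⟨_, rfl⟩
  rw [← hb] at hα
  have hα0 : 0 < α := by linarith
  have hbα : b * α = 1 := by rw [hb]; field_simp
  have hb1 : 1.34 < b := by rw [hb, lt_div_iff₀ hα0]; linarith
  have hb2 : b < 1.343 := by rw [hb, div_lt_iff₀ hα0]; linarith
  have hnN : ((m : ℝ) + 1) / N = 1 / (30 * (m + 1) ^ 2) := by rw [hNr]; field_simp
  have hnN1 : ((m : ℝ) + 1) / N ≤ 1 / (m + 1) := by
    rw [hnN]; exact one_div_le_one_div_of_le (by positivity) (by nlinarith)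
  have hnN2 : ((m : ℝ) + 1) / N ≤ 1 / 30 := by
    rw [hnN]; exact one_div_le_one_div_of_le (by norm_num) (by nlinarith)
  have hnN0 : 0 < ((m : ℝ) + 1) / N := by positivity
  have hm1 : 1 / (m : ℝ) ≤ 1 := by rw [div_le_one (by linarith)]; exact hm0
  have hm2 : 1 / (m : ℝ) ≤ 2 / (m + 1) := by
    rw [div_le_div_iff₀ (by linarith) (by linarith)]; linarith
  have hm3 : 0 < 1 / (m : ℝ) := by positivity
  -- The rate c = 1/d is slightly below α: the two extra terms absorb the right-endpoint error and
  -- the kernel error of `sub_mul_log_pow_le`.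
  obtain ⟨d, hd⟩ : ∃ d, d = b + ((m : ℝ) + 1) / N + 1 / m := ⟨_, rfl⟩
  have hd0 : 0 < d := by linarith
  obtain ⟨c, hc⟩ : ∃ c, c = 1 / d := ⟨_, rfl⟩
  have hc0 : 0 < c := hc ▸ one_div_pos.2 hd0
  have hcd : c * d = 1 := by rw [hc]; field_simp
  have hc1 : c ≤ 1 := by rw [hc, div_le_one hd0]; linarith
  have hc2 : 0.4 ≤ c := by rw [hc, le_div_iff₀ hd0]; linarith
  obtain ⟨w, hw⟩ : ∃ w, w = cellWeight N m := ⟨_, rfl⟩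
  have hw0 : ∀ i < N, 0 ≤ w i := fun i hi => hw ▸ cellWeight_nonneg hN hi
  have hwle : ∀ i < N, w i ≤ m / N := fun i hi => hw ▸ cellWeight_le hN hi
  set u : ℕ → ℝ := fun i => ((i : ℝ) + 1) / N with hu
  have hwN : ∀ i < N, w i ≤ 1 / 30 := fun i hi =>
    (hwle i hi).trans ((div_le_div_of_nonneg_right (by linarith) hN'.le).trans hnN2)
  have hY : ∀ i ≤ N, c * (b - 1 + ((m + 1) * (1 - (i : ℝ) / N) ^ m -
      m * (1 - (i : ℝ) / N) ^ (m + 1) + 1 / m)) ≤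
      1 - c * ((m + 1) * ∑ j ∈ Finset.range i, w j * u j) := by
    intro i hi
    have h := mul_sum_cellWeight_le (m := m) hN hi
    rw [← hw] at h
    have h0 : 0 ≤ (1 - (i : ℝ) / N) ^ m := pow_nonneg (node_bounds hN hi).1 m
    have h3 : ((m : ℝ) + 1) / N * (1 - (1 - (i : ℝ) / N) ^ m) ≤ (m + 1) / N := by nlinarith
    have h4 := mul_le_mul_of_nonneg_left (h.trans (add_le_add_right h3 _)) hc0.le
    have h5 : c * b = 1 - c * (((m : ℝ) + 1) / N) - c * (1 / m) := by
      have h7 : c * d = c * b + c * (((m : ℝ) + 1) / N) + c * (1 / m) := by rw [hd]; ring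
      linarith
    have h6 : c * (b - 1 + ((m + 1) * (1 - (i : ℝ) / N) ^ m -
        m * (1 - (i : ℝ) / N) ^ (m + 1) + 1 / m)) = c * b - c + c * ((m + 1) *
        (1 - (i : ℝ) / N) ^ m - m * (1 - (i : ℝ) / N) ^ (m + 1)) + c * (1 / m) := by ring
    rw [h6, h5]
    linarith
  have hκ : ∀ i ≤ N, c * (b - 1) ≤ 1 - c * ((m + 1) * ∑ j ∈ Finset.range i, w j * u j) := by
    intro i hi
    refine le_trans ?_ (hY i hi)
    obtain ⟨h0, h1⟩ := node_bounds hN hi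
    have h3 : 0 ≤ (1 - (i : ℝ) / N) ^ m := pow_nonneg h0 m
    refine mul_le_mul_of_nonneg_left ?_ hc0.le
    rw [pow_succ]
    nlinarith [mul_nonneg h3 (sub_nonneg.2 h1)]
  have hcb : 1 / 10 ≤ c * (b - 1) := by nlinarith
  have hP := survival_bounds (w := w) (u := u) hc0.le (by linarith : 0 < c * (b - 1))
    hw0 (fun i hi => by
      have := node_succ_bounds hN hi
      exact ⟨by positivity, by linarith⟩) hκ
    (fun i hi => by
      have h3 := hwN i hi
      have h4 := hw0 i hi
      nlinarith)
  obtain ⟨P, hPdef⟩ : ∃ P, P = survival c m w u := ⟨_, rfl⟩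
  rw [← hPdef] at hP
  have hδ1 : ∀ i < N, c * w i / P i ^ m ≤
      w i / ((1 - (i : ℝ) / N) ^ m -
        (1 - (i : ℝ) / N) ^ m * Real.log ((1 - (i : ℝ) / N) ^ m) - 1 + b) := by
    intro i hi
    obtain ⟨hp0, hp1, hp2⟩ := hP i hi.le
    have hwi := hw0 i hi
    have hv0 : 0 < 1 - (i : ℝ) / N := by
      rw [sub_pos, div_lt_one hN']; exact_mod_cast hi
    have hv1 := (node_bounds hN hi.le).2
    have hf := sub_mul_log_pow_le hm hv0 hv1
    have hs0 : 0 ≤ (1 - (i : ℝ) / N) ^ m - (1 - (i : ℝ) / N) ^ m *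
        Real.log ((1 - (i : ℝ) / N) ^ m) :=
      sub_mul_log_nonneg ⟨pow_nonneg hv0.le m, pow_le_one₀ hv0.le hv1⟩
    have hpp : P i ^ (m + 1) ≤ P i ^ m := pow_le_pow_of_le_one hp0.le hp1 (Nat.le_succ m)
    have hle : c * ((1 - (i : ℝ) / N) ^ m -
        (1 - (i : ℝ) / N) ^ m * Real.log ((1 - (i : ℝ) / N) ^ m) - 1 + b) ≤ P i ^ m := by
      refine le_trans ?_ ((hY i hi.le).trans (hp2.trans hpp))
      refine mul_le_mul_of_nonneg_left ?_ hc0.le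
      linarith
    rw [div_le_div_iff₀ (by positivity) (by linarith), mul_right_comm, mul_comm]
    exact mul_le_mul_of_nonneg_left hle hwi
  have hδ0 : ∀ i < N, 0 ≤ c * w i / P i ^ m := fun i hi => by
    have hwi := hw0 i hi
    have := (hP i hi.le).1
    positivity
  -- The denominator in `hδ1` is at least b - 1 > 0.34 > 1/3, and a cell weighs at most m/N.
  have hδe : ∀ i < N, c * w i / P i ^ m ≤ 3 * m / N := by
    intro i hi
    obtain ⟨hv0, hv1⟩ := node_bounds hN hi.le
    have hs0 : 0 ≤ (1 - (i : ℝ) / N) ^ m - (1 - (i : ℝ) / N) ^ m *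
        Real.log ((1 - (i : ℝ) / N) ^ m) :=
      sub_mul_log_nonneg ⟨pow_nonneg hv0 m, pow_le_one₀ hv0 hv1⟩
    have hwi := hw0 i hi
    refine (hδ1 i hi).trans ?_
    rw [div_le_iff₀ (by linarith)]
    have h3 := hwle i hi
    have h4 : 0 ≤ (m : ℝ) / N := by positivity
    rw [mul_div_assoc]
    refine h3.trans ?_
    rw [mul_comm 3 ((m : ℝ) / N), mul_assoc]
    exact le_mul_of_one_le_right h4 (by linarith)
  refine ⟨N, fun i => c * w i / P i ^ m, 3 * m / N, hN, fun i hi => ⟨hδ0 i hi, hδe i hi⟩, ?_, ?_⟩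
  · refine (Finset.sum_le_sum fun i hi => hδ1 i (Finset.mem_range.1 hi)).trans ?_
    rw [hw]
    refine (sum_cellWeight_div_le hN (by linarith : 1 < b) le_rfl).trans ?_
    rw [div_self hN'.ne', sub_self, zero_pow (by omega)]
    exact hα.le
  · intro i hi
    obtain ⟨hp0, hp1, hp2⟩ := hP i hi.le
    have hwi := hw0 i hi
    have hp10 : 1 / 10 ≤ P i := by
      refine hcb.trans ((hκ i hi.le).trans (hp2.trans ?_))
      calc P i ^ (m + 1) ≤ P i ^ 1 := pow_le_pow_of_le_one hp0.le hp1 (by omega)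
        _ = P i := pow_one _
    have hsum : 1 - 3 * m / N - ∑ j ∈ Finset.range i, c * w j / P j ^ m * u j =
        P i - 3 * m / N := by
      have := one_sub_sum_eq_survival c m w u i
      rw [← hPdef] at this
      linarith
    have he0 : 0 ≤ 3 * (m : ℝ) / N := by positivity
    have heN : m * (3 * m / N / P i) ≤ 1 / ((m : ℝ) + 1) := by
      have h3 : 3 * (m : ℝ) / N / P i ≤ 3 * m / N * 10 := by
        rw [div_le_iff₀ hp0]; nlinarith
      calc m * (3 * m / N / P i) ≤ m * (3 * m / N * 10) := by gcongr
        _ = m * m / (m + 1) ^ 3 := by rw [hNr]; field_simp; ring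
        _ ≤ 1 / ((m : ℝ) + 1) := by
          rw [div_le_div_iff₀ (by positivity) (by positivity)]
          nlinarith
    have hm1' : 1 / ((m : ℝ) + 1) ≤ 1 := by rw [div_le_one (by positivity)]; linarith
    have hx1 : 3 * (m : ℝ) / N / P i ≤ 1 := by
      have : 0 ≤ 3 * (m : ℝ) / N / P i := by positivity
      nlinarith
    have hbern : 1 - 1 / ((m : ℝ) + 1) ≤ (1 - 3 * m / N / P i) ^ m := by
      have h3 := one_add_mul_le_pow (a := -(3 * (m : ℝ) / N / P i)) (by linarith) m
      rw [← sub_eq_add_neg] at h3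
      linarith
    have hmax : P i * (1 - 3 * m / N / P i) ≤
        max 0 (1 - 3 * m / N - ∑ j ∈ Finset.range i, c * w j / P j ^ m * u j) := by
      rw [hsum]
      refine le_max_of_le_right (le_of_eq ?_)
      field_simp
    -- The 4 is 1 + 2 + 1: endpoint error, 1/m ≤ 2/(m+1), and Bernoulli loss.
    have hcα : α - 4 / (m + 1) ≤ c * (1 - 1 / (m + 1)) := by
      have h3 : α - (((m : ℝ) + 1) / N + 1 / m) ≤ c := by
        rw [hc, le_div_iff₀ hd0, hd]
        have hε : 0 ≤ ((m : ℝ) + 1) / N + 1 / m := by positivity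
        generalize ((m : ℝ) + 1) / N = a1 at *
        generalize 1 / (m : ℝ) = a2 at *
        nlinarith [mul_nonneg hε (by linarith : 0 ≤ b - α), mul_nonneg hε hε]
      have h4 : c * (1 / ((m : ℝ) + 1)) ≤ 1 * (1 / (m + 1)) := by gcongr
      have h5 : 4 / ((m : ℝ) + 1) = 1 / (m + 1) + 2 / (m + 1) + 1 / (m + 1) := by ring
      rw [h5]
      linarith
    rw [← hw]
    calc (α - 4 / (m + 1)) * w i ≤ c * (1 - 1 / (m + 1)) * w i := by gcongr
      _ = c * w i * (1 - 1 / (m + 1)) := by ring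
      _ ≤ c * w i * (1 - 3 * m / N / P i) ^ m := by gcongr
      _ = c * w i / P i ^ m * (P i * (1 - 3 * m / N / P i)) ^ m := by
        rw [mul_pow]; field_simp
      _ ≤ _ := by
        refine mul_le_mul_of_nonneg_left ?_ (hδ0 i hi)
        exact pow_le_pow_left₀ (mul_nonneg hp0.le (by linarith)) hmax m

/-! ### From quantiles to deterministic thresholds -/

/-- A subderivative of `z ↦ (max 0 z) ^ m`. -/
noncomputable def posPowSlope (m : ℕ) (z : ℝ) : ℝ := if z ≤ 0 then 0 else m * z ^ (m - 1)

lemma posPowSlope_nonneg (m : ℕ) (z : ℝ) : 0 ≤ posPowSlope m z := by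
  unfold posPowSlope
  split_ifs with h
  · exact le_rfl
  · have := (not_le.1 h).le
    positivity

lemma max_zero_pow_tangent {m : ℕ} (hm : 1 ≤ m) (z z₀ : ℝ) :
    max 0 z₀ ^ m + posPowSlope m z₀ * (z - z₀) ≤ max 0 z ^ m := by
  obtain ⟨k, rfl⟩ : ∃ k, m = k + 1 := ⟨m - 1, by omega⟩
  unfold posPowSlope
  split_ifs with h
  · rw [max_eq_left h, zero_pow (Nat.succ_ne_zero k)]
    simp
  · have h0 : 0 < z₀ := not_le.1 h
    rw [max_eq_right h0.le, Nat.add_sub_cancel]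
    have e : z₀ ^ (k + 1) + ((k + 1 : ℕ) : ℝ) * z₀ ^ k * (z - z₀) =
        (k + 1) * (z * z₀ ^ k) - k * z₀ ^ (k + 1) := by push_cast; ring
    rw [e]
    rcases le_total 0 z with hz | hz
    · rw [max_eq_right hz]
      linarith [succ_mul_mul_pow_le hz h0.le k]
    · rw [max_eq_left hz, zero_pow (Nat.succ_ne_zero k)]
      have h1 : z * z₀ ^ k ≤ 0 := mul_nonpos_of_nonpos_of_nonneg hz (by positivity)
      have h2 : 0 ≤ (k : ℝ) * z₀ ^ (k + 1) := by positivity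
      nlinarith [mul_nonpos_of_nonneg_of_nonpos (by positivity : (0 : ℝ) ≤ k + 1) h1]

/-- Optimal thresholds do at least as well as any schedule of quantiles.  Here `g θ` and `r θ` are
the acceptance probability and the partial expectation of a threshold, and `ρ u` is the optimal
partial expectation at acceptance probability `u`. -/
lemma exists_thresholds_ge_quantiles {m : ℕ} (hm : 1 ≤ m) {g r ρ : ℝ → ℝ} (hr : ∀ θ, 0 ≤ r θ)
    (hρ : ∀ u, 0 ≤ ρ u) (h : ∀ θ u, 0 ≤ θ → 0 ≤ u → ρ u + θ * g θ ≤ r θ + θ * u) (N : ℕ) :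
    ∀ (δ u : ℕ → ℝ) (Z : ℝ), (∀ i < N, 0 ≤ δ i) → (∀ i < N, 0 ≤ u i) →
      ∃ θ : ℕ → ℝ, (∀ i, 0 ≤ θ i) ∧
        ∑ i ∈ Finset.range N, δ i * max 0 (Z - ∑ j ∈ Finset.range i, δ j * u j) ^ m * ρ (u i) ≤
        ∑ i ∈ Finset.range N,
          δ i * max 0 (Z - ∑ j ∈ Finset.range i, δ j * g (θ j)) ^ m * r (θ i) := by
  induction N with
  | zero => intro δ u Z _ _; exact ⟨fun _ => 0, fun _ => le_rfl, by simp⟩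
  | succ N ih =>
    intro δ u Z hδ hu
    rcases le_or_gt Z 0 with hZ | hZ
    · refine ⟨fun _ => 0, fun _ => le_rfl, ?_⟩
      refine (Finset.sum_nonpos fun i hi => ?_).trans (Finset.sum_nonneg fun i hi => ?_)
      · have hi := Finset.mem_range.1 hi
        have : 0 ≤ ∑ j ∈ Finset.range i, δ j * u j := Finset.sum_nonneg fun j hj => by
          have hj := Finset.mem_range.1 hj
          exact mul_nonneg (hδ j (by omega)) (hu j (by omega))
        rw [max_eq_left (by linarith), zero_pow (by omega)]
        simp
      · have := hδ i (Finset.mem_range.1 hi)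
        exact mul_nonneg (mul_nonneg this (pow_nonneg (le_max_left _ _) _)) (hr _)
    · set Z₀ := Z - δ 0 * u 0 with hZ₀
      set S : ℕ → ℝ := fun i => ∑ j ∈ Finset.range i, δ (j + 1) * u (j + 1) with hS
      -- `l` is a marginal value of survival for the later stages. Replacing u 0 by the acceptance
      -- probability of θ₀ = l / Z^m changes the later stages by at least l·δ₀·(u₀ - g θ₀), by
      -- convexity. By duality the first stage loses no more than that, or gains at least its
      -- negative. The induction hypothesis then handles the later stages from the new survival
      -- level.
      set l := ∑ i ∈ Finset.range N, δ (i + 1) * posPowSlope m (Z₀ - S i) * ρ (u (i + 1)) with hl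
      have hl0 : 0 ≤ l := Finset.sum_nonneg fun i hi => by
        have := hδ (i + 1) (by have := Finset.mem_range.1 hi; omega)
        exact mul_nonneg (mul_nonneg this (posPowSlope_nonneg _ _)) (hρ _)
      have hZm : 0 < Z ^ m := by positivity
      set θ₀ := l / Z ^ m with hθ₀
      have hθ₀0 : 0 ≤ θ₀ := by positivity
      obtain ⟨θ, hθ0, hθ⟩ := ih (fun i => δ (i + 1)) (fun i => u (i + 1)) (Z - δ 0 * g θ₀)
        (fun i hi => hδ _ (by omega)) (fun i hi => hu _ (by omega))
      refine ⟨fun i => Nat.casesOn i θ₀ θ, fun i => ?_, ?_⟩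
      · cases i with
        | zero => exact hθ₀0
        | succ i => exact hθ0 i
      rw [Finset.sum_range_succ', Finset.sum_range_succ']
      simp only [Finset.sum_range_zero, sub_zero, Finset.sum_range_succ' _ (_ : ℕ)]
      have hshift : ∀ i, Z - (∑ j ∈ Finset.range i, δ (j + 1) * u (j + 1) + δ 0 * u 0) =
          Z₀ - S i := fun i => by rw [hZ₀, hS]; ring
      have hshift' : ∀ i, Z - (∑ j ∈ Finset.range i, δ (j + 1) * g (θ j) + δ 0 * g θ₀) =
          Z - δ 0 * g θ₀ - ∑ j ∈ Finset.range i, δ (j + 1) * g (θ j) := fun i => by ring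
      simp only [Nat.rec_zero, hshift, hshift', max_eq_right hZ.le]
      have htan : ∑ i ∈ Finset.range N, δ (i + 1) * max 0 (Z₀ - S i) ^ m * ρ (u (i + 1)) +
          l * (δ 0 * (u 0 - g θ₀)) ≤
          ∑ i ∈ Finset.range N,
            δ (i + 1) * max 0 (Z - δ 0 * g θ₀ - S i) ^ m * ρ (u (i + 1)) := by
        rw [hl, Finset.sum_mul, ← Finset.sum_add_distrib]
        refine Finset.sum_le_sum fun i hi => ?_
        have hd := hδ (i + 1) (by have := Finset.mem_range.1 hi; omega)
        have ht := max_zero_pow_tangent hm (Z - δ 0 * g θ₀ - S i) (Z₀ - S i)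
        have e : Z - δ 0 * g θ₀ - S i - (Z₀ - S i) = δ 0 * (u 0 - g θ₀) := by rw [hZ₀]; ring
        rw [e] at ht
        have ht' := mul_le_mul_of_nonneg_left ht (mul_nonneg hd (hρ (u (i + 1))))
        linarith
      have hfirst := mul_le_mul_of_nonneg_left (h θ₀ (u 0) hθ₀0 (hu 0 (by omega)))
        (mul_nonneg (hδ 0 (by omega)) hZm.le)
      have hlθ : l = θ₀ * Z ^ m := by rw [hθ₀]; field_simp
      rw [hlθ] at htan
      have hrest := htan.trans hθ
      linarith

/-! ### The benchmark as a mixture of top masses -/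

lemma measurable_measure_lt (μ : Measure Ω) (x : Ω → ℝ) :
    Measurable fun z : ℝ => μ {ω | z < x ω} :=
  Antitone.measurable fun _ _ hab => measure_mono fun _ hω => lt_of_le_of_lt hab hω

lemma lintegral_ofReal_sub_eq {μ : Measure Ω} {x : Ω → ℝ} (hx : Measurable x) (θ : ℝ) :
    ∫⁻ ω, ENNReal.ofReal (x ω - θ) ∂μ = ∫⁻ z in Set.Ioi θ, μ {ω | z < x ω} := by
  have h1 : ∫⁻ ω, ENNReal.ofReal (x ω - θ) ∂μ = ∫⁻ ω, ENNReal.ofReal (max (x ω - θ) 0) ∂μ := by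
    refine lintegral_congr fun ω => ?_
    rw [ENNReal.ofReal_max]; simp
  rw [h1, lintegral_eq_lintegral_meas_lt (f := fun ω => max (x ω - θ) 0) μ (Filter.Eventually.of_forall fun ω => le_max_right _ _)
    ((hx.sub_const θ).max measurable_const).aemeasurable]
  rw [← lintegral_indicator measurableSet_Ioi, ← lintegral_indicator measurableSet_Ioi,
    ← lintegral_add_right_eq_self ((Set.Ioi θ).indicator fun z => μ {ω | z < x ω}) θ]
  refine lintegral_congr fun t => ?_
  by_cases ht : 0 < t
  · rw [Set.indicator_of_mem (show t ∈ Set.Ioi 0 from ht),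
      Set.indicator_of_mem (show t + θ ∈ Set.Ioi θ by simpa using ht)]
    congr 1
    ext ω
    simp only [Set.mem_ofPred_eq, lt_max_iff]
    constructor
    · rintro (h | h) <;> linarith
    · intro h; left; linarith
  · rw [Set.indicator_of_notMem (show t ∉ Set.Ioi 0 from ht),
      Set.indicator_of_notMem (show t + θ ∉ Set.Ioi θ by simpa using ht)]

/-- The optimal partial expectation of `x` at acceptance probability `v`. -/
noncomputable def topMass (μ : Measure Ω) (x : Ω → ℝ) (v : ℝ) : ℝ≥0∞ :=
  ∫⁻ z in Set.Ioi (0 : ℝ), min (ENNReal.ofReal v) (μ {ω | z < x ω})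

lemma topMass_le_lintegral (μ : Measure Ω) {x : Ω → ℝ} (hx : Measurable x) (v : ℝ) :
    topMass μ x v ≤ ∫⁻ ω, ENNReal.ofReal (x ω) ∂μ := by
  have h := lintegral_ofReal_sub_eq (μ := μ) hx 0
  simp only [sub_zero] at h
  rw [h]
  exact lintegral_mono fun z => min_le_right _ _

/-- Weak duality with multiplier θ: bound the minimum by v below level θ and by the tail above it.
-/
lemma topMass_le (μ : Measure Ω) {x : Ω → ℝ} (hx : Measurable x) {θ : ℝ} (hθ : 0 ≤ θ) (v : ℝ) :
    topMass μ x v ≤ ENNReal.ofReal θ * ENNReal.ofReal v + ∫⁻ ω, ENNReal.ofReal (x ω - θ) ∂μ := by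
  rw [lintegral_ofReal_sub_eq hx, topMass, ← Set.Ioc_union_Ioi_eq_Ioi hθ]
  refine (lintegral_union_le _ _ _).trans ?_
  gcongr
  · refine (setLIntegral_mono measurable_const fun z _ => min_le_left _ _).trans (le_of_eq ?_)
    rw [setLIntegral_const, Real.volume_Ioc, sub_zero, mul_comm]
  · exact min_le_right _ _

/-- Discrete form of 1 - (1 - g)^n = n ∫ m (1 - u)^(m-1) min(u, g) du, by summation by parts; the
boundary term in `key` vanishes at k = N. -/
lemma one_sub_pow_le_sum_cellWeight {N m : ℕ} (hN : 0 < N) (hm : 1 ≤ m) {g : ℝ} (hg0 : 0 ≤ g)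
    (hg1 : g ≤ 1) :
    1 - (1 - g) ^ (m + 1) ≤
      (m + 1) * ∑ i ∈ Finset.range N, cellWeight N m i * min (((i : ℝ) + 1) / N) g := by
  have hN' : (0 : ℝ) < N := by exact_mod_cast hN
  have key : ∀ k ≤ N, 1 - (1 - min ((k : ℝ) / N) g) ^ (m + 1) ≤
      (m + 1) * (∑ i ∈ Finset.range k, cellWeight N m i * min (((i : ℝ) + 1) / N) g +
        (1 - (k : ℝ) / N) ^ m * min ((k : ℝ) / N) g) := by
    intro k
    induction k with
    | zero => intro _; simp [hg0]
    | succ k ih =>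
      intro hk
      have ih := ih (by omega)
      rw [Finset.sum_range_succ]
      push_cast
      set a := min ((k : ℝ) / N) g with ha
      set b := min (((k : ℝ) + 1) / N) g with hb
      have hab : a ≤ b := min_le_min_right _ (by gcongr; linarith)
      have hb1 : b ≤ 1 := (min_le_right _ _).trans hg1
      have hbern := succ_mul_mul_pow_le (sub_nonneg.2 hb1) (sub_nonneg.2 (hab.trans hb1)) m
      -- Once the nodes pass g the increment b - a is zero, so 1 - a may be replaced by the node
      -- value.
      have heq : (1 - a) ^ m * (b - a) = (1 - (k : ℝ) / N) ^ m * (b - a) := by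
        rcases le_total ((k : ℝ) / N) g with h | h
        · rw [ha, min_eq_left h]
        · have h1 : a = g := min_eq_right h
          have h2 : b = g := min_eq_right (h.trans (by gcongr; linarith))
          rw [h1, h2]; simp
      have e1 : (m + 1 : ℝ) * ((1 - b) * (1 - a) ^ m) =
          (m + 1) * (1 - a) ^ (m + 1) - (m + 1) * ((1 - a) ^ m * (b - a)) := by ring
      rw [e1, heq] at hbern
      unfold cellWeight at ih ⊢
      linarith
  have h := key N le_rfl
  rw [div_self hN'.ne', min_eq_right hg1, sub_self, zero_pow (by omega), zero_mul, add_zero] at h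
  exact h

/-- Layer cake: the maximum exceeds z with probability 1 - (1 - g)^n, where g = P(x > z), so the
pointwise bound `one_sub_pow_le_sum_cellWeight` integrates over z to top masses. -/
lemma searchValue_le_sum_topMass {N m : ℕ} (hN : 0 < N) (hm : 1 ≤ m) (μ : Measure Ω)
    [IsProbabilityMeasure μ] {x : Ω → ℝ} (hx : Measurable x) (hx0 : ∀ ω, 0 ≤ x ω) :
    searchValue (fun _ : Fin (m + 1) => μ) x ≤
      ENNReal.ofReal (m + 1) * ∑ i ∈ Finset.range N, ENNReal.ofReal (cellWeight N m i) *
        topMass μ x (((i : ℝ) + 1) / N) := by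
  set f : (Fin (m + 1) → Ω) → ℝ := fun s =>
    Finset.univ.sup' Finset.univ_nonempty fun i => x (s i) with hf
  have hfm : Measurable f := by
    have := Finset.measurable_sup' (s := (Finset.univ : Finset (Fin (m + 1))))
      Finset.univ_nonempty (f := fun i (s : Fin (m + 1) → Ω) => x (s i))
      fun i _ => hx.comp (measurable_pi_apply i)
    convert this using 1
    ext s
    simp [hf, Finset.sup'_apply]
  have hf0 : ∀ s, 0 ≤ f s := fun s =>
    (hx0 (s 0)).trans (Finset.le_sup' (fun i => x (s i)) (Finset.mem_univ 0))
  have h1 : searchValue (fun _ : Fin (m + 1) => μ) x ≤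
      ∫⁻ s, ENNReal.ofReal (f s) ∂(Measure.pi fun _ : Fin (m + 1) => μ) :=
    lintegral_mono fun s => iSup_le fun i => ENNReal.ofReal_le_ofReal
      (Finset.le_sup' (fun i => x (s i)) (Finset.mem_univ i))
  rw [lintegral_eq_lintegral_meas_lt _ (Filter.Eventually.of_forall hf0) hfm.aemeasurable] at h1
  refine h1.trans ?_
  have hmeas : ∀ v, Measurable fun z : ℝ => min (ENNReal.ofReal v) (μ {ω | z < x ω}) :=
    fun v => measurable_const.min (measurable_measure_lt μ x)
  simp_rw [topMass, ← lintegral_const_mul _ (hmeas _)]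
  rw [← lintegral_finsetSum _ fun i _ => (hmeas _).const_mul _, ← lintegral_const_mul _
    (Finset.measurable_sum _ fun i _ => (hmeas _).const_mul _)]
  refine lintegral_mono fun z => ?_
  have hgm : MeasurableSet {ω | z < x ω} := measurableSet_lt measurable_const hx
  set g := μ.real {ω | z < x ω} with hg
  have hg0 : 0 ≤ g := measureReal_nonneg
  have hg1 : g ≤ 1 := measureReal_le_one
  have hμg : μ {ω | z < x ω} = ENNReal.ofReal g := (ofReal_measureReal).symm
  have hset : {s : Fin (m + 1) → Ω | z < f s} = (Set.univ.pi fun _ => {ω | z < x ω}ᶜ)ᶜ := by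
    ext s
    simp [hf, Finset.lt_sup'_iff]
  have hpi : Measure.pi (fun _ : Fin (m + 1) => μ) {s | z < f s} =
      ENNReal.ofReal (1 - (1 - g) ^ (m + 1)) := by
    rw [hset, prob_compl_eq_one_sub (MeasurableSet.univ_pi fun _ => hgm.compl), Measure.pi_pi,
      Finset.prod_const, Finset.card_univ, Fintype.card_fin, prob_compl_eq_one_sub hgm, hμg,
      ENNReal.ofReal_sub _ (by have : 0 ≤ 1 - g := by linarith
                               positivity), ENNReal.ofReal_one,
      ENNReal.ofReal_pow (by linarith), ENNReal.ofReal_sub _ hg0, ENNReal.ofReal_one]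
  rw [hpi]
  refine (ENNReal.ofReal_le_ofReal (one_sub_pow_le_sum_cellWeight hN hm hg0 hg1)).trans ?_
  rw [ENNReal.ofReal_mul (by positivity), ENNReal.ofReal_sum_of_nonneg]
  · gcongr with i hi
    rw [ENNReal.ofReal_mul (cellWeight_nonneg hN (Finset.mem_range.1 hi)), hμg, ENNReal.ofReal_min]
  · intro i hi
    exact mul_nonneg (cellWeight_nonneg hN (Finset.mem_range.1 hi)) (le_min (by positivity) hg0)

/-! ### Realizing a schedule as an eligible set -/

lemma setLIntegral_inter_preimage_of_indepFun {μ : Measure Ω} {f g : Ω → ℝ} (hf : Measurable f)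
    (hg : Measurable g) (hfg : IndepFun f g μ) {φ : ℝ → ℝ≥0∞} (hφ : Measurable φ)
    {S T : Set ℝ} (hS : MeasurableSet S) (hT : MeasurableSet T) :
    ∫⁻ ω in f ⁻¹' S ∩ g ⁻¹' T, φ (f ω) ∂μ = (∫⁻ ω in f ⁻¹' S, φ (f ω) ∂μ) * μ (g ⁻¹' T) := by
  have h := setLIntegral_preimage_mul_of_indepFun hf hg hfg hφ
    ((measurable_one : Measurable (1 : ℝ → ℝ≥0∞)).indicator hT) hS
  have h2 : ∫⁻ ω, T.indicator 1 (g ω) ∂μ = μ (g ⁻¹' T) := by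
    rw [← lintegral_indicator_one (hg hT)]
    rfl
  rw [h2] at h
  rw [← h, Set.inter_comm, ← Measure.restrict_restrict (hg hT), ← lintegral_indicator (hg hT)]
  refine lintegral_congr fun ω => ?_
  by_cases hω : g ω ∈ T
  · rw [Set.indicator_of_mem (show ω ∈ g ⁻¹' T from hω)]; simp [hω]
  · rw [Set.indicator_of_notMem (show ω ∉ g ⁻¹' T from hω)]; simp [hω]

/-- A schedule of thresholds on `x`, to be used for given amounts of the upper quantiles of `y`,
as an eligible set. -/
lemma exists_thresholdFunction_of_schedule {m N : ℕ} {μ : Measure Ω} [IsProbabilityMeasure μ]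
    {x y : Ω → ℝ} (hx : Measurable x) (hy : Measurable y) (hy0 : ∀ ω, 0 ≤ y ω)
    (hya : Atomless μ y) (hxy : IndepFun x y μ) {δ : ℕ → ℝ} (hδ : ∀ i < N, 0 ≤ δ i)
    (hδ1 : ∑ i ∈ Finset.range N, δ i ≤ 1) (θ : ℕ → ℝ) :
    ∃ Θ : ℝ → ℝ, Measurable Θ ∧
      ∀ σ : Strategy (singleProposal {ω | Θ (y ω) < x ω}) (m + 1),
        IsBestResponse (singleProposal {ω | Θ (y ω) < x ω}) y σ →
        (m + 1 : ℝ≥0∞) * ∑ i ∈ Finset.range N, ENNReal.ofReal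
            (1 - ∑ j ∈ Finset.range (i + 1), δ j * μ.real (x ⁻¹' Set.Ioi (θ j))) ^ m *
            ((∫⁻ ω in x ⁻¹' Set.Ioi (θ i), ENNReal.ofReal (x ω) ∂μ) * ENNReal.ofReal (δ i)) ≤
          delegationValue (fun _ : Fin (m + 1) => μ) x
            (singleProposal {ω | Θ (y ω) < x ω}) σ := by
  set T : ℝ → ℝ := fun v => μ.real {ω | v < y ω} with hT
  have hTanti : Antitone T := fun v w h => measureReal_mono fun ω hω => lt_of_le_of_lt h hω
  have hTm : Measurable T := hTanti.measurable
  set Δ : ℕ → ℝ := fun k => ∑ j ∈ Finset.range k, δ j with hΔ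
  have hΔmono : ∀ {i j}, i ≤ j → j ≤ N → Δ i ≤ Δ j := fun {i j} hij hj =>
    Finset.sum_le_sum_of_subset_of_nonneg (Finset.range_mono hij) fun k hk _ =>
      hδ k (by have := Finset.mem_range.1 hk; omega)
  have hΔ0 : ∀ {i}, i ≤ N → 0 ≤ Δ i := fun {i} hi => by
    simpa [hΔ] using hΔmono (Nat.zero_le i) hi
  have hΔ1 : ∀ {i}, i ≤ N → Δ i ≤ 1 := fun {i} hi => (hΔmono hi le_rfl).trans hδ1
  -- Cell i holds the values of y whose time `T` lies in a slot of length δ i; it has mass δ i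
  -- because `T` of y is uniform.
  set cell : ℕ → Set ℝ := fun i => {v | Δ i ≤ T v ∧ T v < Δ (i + 1)} with hcell
  have hcm : ∀ i, MeasurableSet (cell i) := fun i =>
    (measurableSet_le measurable_const hTm).inter (measurableSet_lt hTm measurable_const)
  have huniq : ∀ {v i j}, i < N → j < N → v ∈ cell i → v ∈ cell j → i = j := by
    intro v i j hi hj hvi hvj
    by_contra hne
    rcases lt_or_gt_of_ne hne with h | h
    · exact absurd (hvi.2.trans_le (hΔmono h (by omega))) (not_lt.2 hvj.1)
    · exact absurd (hvj.2.trans_le (hΔmono h (by omega))) (not_lt.2 hvi.1)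
  have hexists : ∀ {v} k, T v < Δ k → ∃ j < k, v ∈ cell j := by
    intro v k
    induction k with
    | zero => intro h; exact absurd h (not_lt.2 (by simp [hΔ, hT, measureReal_nonneg]))
    | succ k ih =>
      intro h
      rcases lt_or_ge (T v) (Δ k) with h' | h'
      · obtain ⟨j, hj, hv⟩ := ih h'
        exact ⟨j, by omega, hv⟩
      · exact ⟨k, by omega, h', h⟩
  have hcellμ : ∀ i < N, μ (y ⁻¹' cell i) = ENNReal.ofReal (δ i) := by
    intro i hi
    have h1 := measureReal_tail_lt hy hya (hΔ0 (i := i + 1) hi) (hΔ1 hi)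
    have h2 := measureReal_tail_lt hy hya (hΔ0 (i := i) hi.le) (hΔ1 hi.le)
    have hset : y ⁻¹' cell i = {ω | T (y ω) < Δ (i + 1)} \ {ω | T (y ω) < Δ i} := by
      ext ω
      simp only [hcell, Set.mem_preimage, Set.mem_ofPred_eq, Set.mem_sdiff, not_lt]
      tauto
    have hsub : {ω | T (y ω) < Δ i} ⊆ {ω | T (y ω) < Δ (i + 1)} :=
      fun ω hω => lt_of_lt_of_le hω (hΔmono (Nat.le_succ i) hi)
    have hms : MeasurableSet {ω | T (y ω) < Δ i} :=
      measurableSet_lt (hTm.comp hy) measurable_const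
    rw [← ofReal_measureReal, hset, measureReal_sdiff hsub hms]
    congr 1
    calc _ = Δ (i + 1) - Δ i := congrArg₂ _ h1 h2
      _ = δ i := by simp [hΔ, Finset.sum_range_succ]
  -- Outside all cells the threshold is 0. Those samples come after every cell, and their
  -- contribution is dropped from the lower bound.
  set Θ : ℝ → ℝ := fun v => ∑ i ∈ Finset.range N, (cell i).indicator (fun _ => θ i) v with hΘdef
  have hΘm : Measurable Θ :=
    Finset.measurable_sum _ fun i _ => measurable_const.indicator (hcm i)
  have hΘ : ∀ {v i}, i < N → v ∈ cell i → Θ v = θ i := by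
    intro v i hi hv
    rw [hΘdef]
    dsimp only
    rw [Finset.sum_eq_single i]
    · exact Set.indicator_of_mem hv _
    · intro j hj hji
      exact Set.indicator_of_notMem (fun h => hji (huniq (Finset.mem_range.1 hj) hi h hv)) _
    · intro h; exact absurd (Finset.mem_range.2 hi) h
  refine ⟨Θ, hΘm, fun σ hσ => ?_⟩
  have hRm : MeasurableSet {ω | Θ (y ω) < x ω} := measurableSet_lt (hΘm.comp hy) hx
  refine le_trans ?_ (le_delegationValue μ hx hy hy0 hya hRm hσ)
  gcongr
  set D : ℕ → Set Ω := fun i => x ⁻¹' Set.Ioi (θ i) ∩ y ⁻¹' cell i with hD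
  have hDm : ∀ i, MeasurableSet (D i) := fun i => (hx measurableSet_Ioi).inter (hy (hcm i))
  have hDsub : (⋃ i ∈ Finset.range N, D i) ⊆ {ω | Θ (y ω) < x ω} := by
    refine Set.iUnion₂_subset fun i hi ω hω => ?_
    have h1 : θ i < x ω := hω.1
    rw [← hΘ (Finset.mem_range.1 hi) hω.2] at h1
    exact h1
  have hDdisj : (Finset.range N : Set ℕ).PairwiseDisjoint D := by
    intro i hi j hj hij
    refine Set.disjoint_left.2 fun ω h1 h2 => hij ?_
    exact huniq (by simpa using hi) (by simpa using hj) h1.2 h2.2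
  refine le_trans ?_ (lintegral_mono_set hDsub)
  rw [lintegral_biUnion_finset hDdisj fun i _ => hDm i]
  refine Finset.sum_le_sum fun i hi => ?_
  have hi := Finset.mem_range.1 hi
  rw [← hcellμ i hi, ← setLIntegral_inter_preimage_of_indepFun hx hy hxy
    ENNReal.measurable_ofReal measurableSet_Ioi (hcm i),
    ← lintegral_const_mul _ hx.ennreal_ofReal]
  refine setLIntegral_mono' (hDm i) fun ω hω => ?_
  rw [mul_comm]
  gcongr
  set A := {ω' | ω' ∈ {ω | Θ (y ω) < x ω} → y ω' < y ω} with hA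
  -- An eligible competitor that is at least as good for the agent has no later time, hence lies in
  -- a cell j ≤ i. The whole of cell i is counted, hence `i + 1`.
  have hAc : Aᶜ ⊆ ⋃ j ∈ Finset.range (i + 1), D j := by
    intro ω' hω'
    simp only [hA, Set.mem_compl_iff, Set.mem_ofPred_eq, Classical.not_imp, not_lt] at hω'
    obtain ⟨j, hj, hv⟩ := hexists (i + 1) ((hTanti hω'.2).trans_lt hω.2.2)
    refine Set.mem_biUnion (Finset.mem_coe.2 (Finset.mem_range.2 hj)) ⟨?_, hv⟩
    have := hω'.1
    rw [hΘ (by omega) hv] at this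
    exact this
  have hμD : ∀ j ∈ Finset.range (i + 1),
      μ (D j) = ENNReal.ofReal (δ j * μ.real (x ⁻¹' Set.Ioi (θ j))) := by
    intro j hj
    have hj := Finset.mem_range.1 hj
    rw [hD, hxy.measure_inter_preimage_eq_mul _ _ measurableSet_Ioi (hcm j),
      hcellμ j (by omega), ENNReal.ofReal_mul (hδ j (by omega)), ofReal_measureReal, mul_comm]
  have hAcμ : μ Aᶜ ≤ ENNReal.ofReal
      (∑ j ∈ Finset.range (i + 1), δ j * μ.real (x ⁻¹' Set.Ioi (θ j))) := by
    rw [ENNReal.ofReal_sum_of_nonneg fun j hj => mul_nonneg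
      (hδ j (by have := Finset.mem_range.1 hj; omega)) measureReal_nonneg,
      ← Finset.sum_congr rfl hμD]
    exact (measure_mono hAc).trans (measure_biUnion_finset_le _ _)
  rw [ENNReal.ofReal_sub _ (Finset.sum_nonneg fun j hj => mul_nonneg
    (hδ j (by have := Finset.mem_range.1 hj; omega)) measureReal_nonneg), ENNReal.ofReal_one,
    tsub_le_iff_right]
  calc (1 : ℝ≥0∞) = μ Set.univ := measure_univ.symm
    _ ≤ μ A + μ Aᶜ := measure_univ_le_add_compl A
    _ ≤ _ := by gcongr

/-! ### Assembling the bound for threshold functions -/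

/-- For at least two samples and `x` of finite mean, a threshold function gives an `α - O(1/n)`
fraction of the value of searching directly. -/
lemma exists_thresholdFunction_of_two_le {α : ℝ} (h1 : 0.745 < α) (h2 : α < 0.746)
    (hα : hillKertz (1 / α) = 1) {m : ℕ} (hm : 1 ≤ m) {μ : Measure Ω} [IsProbabilityMeasure μ]
    {x y : Ω → ℝ} (hx : Measurable x) (hx0 : ∀ ω, 0 ≤ x ω)
    (hxi : ∫⁻ ω, ENNReal.ofReal (x ω) ∂μ ≠ ∞) (hy : Measurable y)
    (hy0 : ∀ ω, 0 ≤ y ω) (hya : Atomless μ y) (hxy : IndepFun x y μ) :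
    ∃ Θ : ℝ → ℝ, Measurable Θ ∧
      ∀ σ : Strategy (singleProposal {ω | Θ (y ω) < x ω}) (m + 1),
        IsBestResponse (singleProposal {ω | Θ (y ω) < x ω}) y σ →
        ENNReal.ofReal (α - 4 / (m + 1)) * searchValue (fun _ : Fin (m + 1) => μ) x ≤
          delegationValue (fun _ : Fin (m + 1) => μ) x
            (singleProposal {ω | Θ (y ω) < x ω}) σ := by
  obtain ⟨N, δ, e, hN, hδ, hδ1, hw⟩ := exists_schedule h1 h2 hα hm
  have hN' : (0 : ℝ) < N := by exact_mod_cast hN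
  set g : ℝ → ℝ := fun t => μ.real (x ⁻¹' Set.Ioi t) with hg
  set r : ℝ → ℝ := fun t => (∫⁻ ω in x ⁻¹' Set.Ioi t, ENNReal.ofReal (x ω) ∂μ).toReal with hr
  set ρ : ℝ → ℝ := fun v => (topMass μ x v).toReal with hρ
  have hrtop : ∀ t, ∫⁻ ω in x ⁻¹' Set.Ioi t, ENNReal.ofReal (x ω) ∂μ ≠ ∞ := fun t =>
    ((setLIntegral_le_lintegral _ _).trans_lt hxi.lt_top).ne
  have hρtop : ∀ v, topMass μ x v ≠ ∞ := fun v =>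
    ((topMass_le_lintegral μ hx v).trans_lt hxi.lt_top).ne
  have hdual : ∀ t v, 0 ≤ t → 0 ≤ v → ρ v + t * g t ≤ r t + t * v := by
    intro t v ht hv
    have ha := topMass_le μ hx ht v
    have hb := setLIntegral_Ioi_eq_excess_add (μ := μ) hx ht
    have hc : topMass μ x v + ENNReal.ofReal t * μ (x ⁻¹' Set.Ioi t) ≤
        (∫⁻ ω in x ⁻¹' Set.Ioi t, ENNReal.ofReal (x ω) ∂μ) +
          ENNReal.ofReal t * ENNReal.ofReal v := by
      rw [hb]
      calc _ ≤ (ENNReal.ofReal t * ENNReal.ofReal v + ∫⁻ ω, ENNReal.ofReal (x ω - t) ∂μ) +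
            ENNReal.ofReal t * μ (x ⁻¹' Set.Ioi t) := by gcongr
        _ = _ := by ring
    have hd := ENNReal.toReal_mono (ENNReal.add_ne_top.2 ⟨hrtop t,
      ENNReal.mul_ne_top ENNReal.ofReal_ne_top ENNReal.ofReal_ne_top⟩) hc
    rw [ENNReal.toReal_add (hρtop v) (ENNReal.mul_ne_top ENNReal.ofReal_ne_top
      (measure_ne_top _ _)), ENNReal.toReal_add (hrtop t)
      (ENNReal.mul_ne_top ENNReal.ofReal_ne_top ENNReal.ofReal_ne_top), ENNReal.toReal_mul,
      ENNReal.toReal_mul, ENNReal.toReal_ofReal ht, ENNReal.toReal_ofReal hv] at hd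
    exact hd
  obtain ⟨θ, hθ0, hθ⟩ := exists_thresholds_ge_quantiles hm
    (fun _ => ENNReal.toReal_nonneg) (fun _ => ENNReal.toReal_nonneg) hdual N δ
    (fun i => ((i : ℝ) + 1) / N) (1 - e) (fun i hi => (hδ i hi).1) (fun i _ => by positivity)
  obtain ⟨Θ, hΘm, hΘ⟩ := exists_thresholdFunction_of_schedule (m := m) hx hy hy0 hya hxy
    (fun i hi => (hδ i hi).1) hδ1 θ
  refine ⟨Θ, hΘm, fun σ hσ => le_trans ?_ (hΘ σ hσ)⟩
  have hn : (m + 1 : ℝ≥0∞) = ENNReal.ofReal (m + 1) := by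
    rw [ENNReal.ofReal_add (by positivity) (by positivity)]; simp
  have hsearch : searchValue (fun _ : Fin (m + 1) => μ) x ≤ ENNReal.ofReal
      ((m + 1) * ∑ i ∈ Finset.range N, cellWeight N m i * ρ (((i : ℝ) + 1) / N)) := by
    refine (searchValue_le_sum_topMass hN hm μ hx hx0).trans (le_of_eq ?_)
    rw [ENNReal.ofReal_mul (by positivity), ENNReal.ofReal_sum_of_nonneg]
    · congr 1
      refine Finset.sum_congr rfl fun i hi => ?_
      rw [ENNReal.ofReal_mul (cellWeight_nonneg hN (Finset.mem_range.1 hi)),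
        ENNReal.ofReal_toReal (hρtop _)]
    · intro i hi
      exact mul_nonneg (cellWeight_nonneg hN (Finset.mem_range.1 hi)) ENNReal.toReal_nonneg
  have hreal : (α - 4 / (m + 1)) *
      ∑ i ∈ Finset.range N, cellWeight N m i * ρ (((i : ℝ) + 1) / N) ≤
      ∑ i ∈ Finset.range N,
        δ i * max 0 (1 - e - ∑ j ∈ Finset.range i, δ j * g (θ j)) ^ m * r (θ i) := by
    refine le_trans ?_ hθ
    rw [Finset.mul_sum]
    refine Finset.sum_le_sum fun i hi => ?_
    rw [← mul_assoc]
    exact mul_le_mul_of_nonneg_right (hw i (Finset.mem_range.1 hi)) ENNReal.toReal_nonneg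
  have hsum0 : 0 ≤ ∑ i ∈ Finset.range N, cellWeight N m i * ρ (((i : ℝ) + 1) / N) :=
    Finset.sum_nonneg fun i hi =>
      mul_nonneg (cellWeight_nonneg hN (Finset.mem_range.1 hi)) ENNReal.toReal_nonneg
  calc ENNReal.ofReal (α - 4 / (m + 1)) * searchValue (fun _ : Fin (m + 1) => μ) x
      ≤ ENNReal.ofReal (α - 4 / (m + 1)) * ENNReal.ofReal
        ((m + 1) * ∑ i ∈ Finset.range N, cellWeight N m i * ρ (((i : ℝ) + 1) / N)) := by gcongr
    _ = ENNReal.ofReal (m + 1) * ENNReal.ofReal ((α - 4 / (m + 1)) *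
        ∑ i ∈ Finset.range N, cellWeight N m i * ρ (((i : ℝ) + 1) / N)) := by
      rw [ENNReal.ofReal_mul (by positivity), ENNReal.ofReal_mul' hsum0]
      ring
    _ ≤ ENNReal.ofReal (m + 1) * ENNReal.ofReal (∑ i ∈ Finset.range N,
        δ i * max 0 (1 - e - ∑ j ∈ Finset.range i, δ j * g (θ j)) ^ m * r (θ i)) := by
      gcongr
    _ ≤ _ := by
      rw [hn, ENNReal.ofReal_sum_of_nonneg]
      · gcongr with i hi
        have hi := Finset.mem_range.1 hi
        obtain ⟨hd0, hde⟩ := hδ i hi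
        rw [mul_right_comm, mul_comm, ENNReal.ofReal_mul (by positivity),
          ENNReal.ofReal_pow (le_max_left _ _), mul_comm (δ i), ENNReal.ofReal_mul
          ENNReal.toReal_nonneg, ENNReal.ofReal_toReal (hrtop _)]
        gcongr
        -- The slack e in the initial survival 1 - e pays for competitors in the sample's own cell.
        have hg1 : δ i * g (θ i) ≤ e :=
          (mul_le_of_le_one_right hd0 measureReal_le_one).trans hde
        refine max_le (sub_nonneg.2 ?_) ?_
        · refine le_trans (Finset.sum_le_sum fun j hj => mul_le_of_le_one_right
            (hδ j (by have := Finset.mem_range.1 hj; omega)).1 measureReal_le_one) (le_trans ?_ hδ1)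
          exact Finset.sum_le_sum_of_subset_of_nonneg (Finset.range_mono hi) fun j hj _ =>
            (hδ j (Finset.mem_range.1 hj)).1
        · rw [Finset.sum_range_succ]
          linarith
      · intro i hi
        exact mul_nonneg (mul_nonneg (hδ i (Finset.mem_range.1 hi)).1
          (pow_nonneg (le_max_left _ _) _)) ENNReal.toReal_nonneg

/-- A threshold on the principal's utility that depends on the agent's utility gives an
`α - O(log n / n)` fraction of the value of searching directly. -/
theorem exists_thresholdFunction {α : ℝ} (h1 : 0.745 < α) (h2 : α < 0.746)
    (hα : hillKertz (1 / α) = 1) {n : ℕ} (hn : 1 ≤ n) {μ : Measure Ω} [IsProbabilityMeasure μ]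
    {x y : Ω → ℝ} (hx : Measurable x) (hx0 : ∀ ω, 0 ≤ x ω) (hy : Measurable y)
    (hy0 : ∀ ω, 0 ≤ y ω) (hya : Atomless μ y) (hxy : IndepFun x y μ) :
    ∃ R : Set Ω, IsThresholdFunctionSet x y R ∧
      ∀ σ : Strategy (singleProposal R) n, IsBestResponse (singleProposal R) y σ →
        ENNReal.ofReal (α - 4 / Real.log 2 * Real.log n / n) *
            searchValue (fun _ : Fin n => μ) x ≤
          delegationValue (fun _ : Fin n => μ) x (singleProposal R) σ := by
  obtain ⟨m, rfl⟩ : ∃ m, n = m + 1 := ⟨n - 1, by omega⟩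
  -- Accepting everything yields at least the mean of x, which suffices for one sample (log 1 = 0,
  -- so no loss is allowed there) and when the mean is infinite.
  by_cases htriv : m = 0 ∨ ∫⁻ ω, ENNReal.ofReal (x ω) ∂μ = ∞
  · refine ⟨x ⁻¹' Set.Ici 0, ⟨fun _ => 0, measurable_const, Or.inl rfl⟩, fun σ hσ => ?_⟩
    have h := lintegral_le_delegationValue_univ hx hx0 hy hy0 hya hxy hσ
    rcases htriv with rfl | htop
    · have hS := searchValue_le_add_sum (fun _ : Fin (0 + 1) => μ) hx 0
      have hle : ENNReal.ofReal (α - 4 / Real.log 2 * Real.log ((0 + 1 : ℕ) : ℝ) /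
          ((0 + 1 : ℕ) : ℝ)) ≤ 1 := by
        rw [ENNReal.ofReal_le_one]
        simp only [zero_add, Nat.cast_one, Real.log_one, mul_zero, zero_div, sub_zero]
        linarith
      refine le_trans (mul_le_of_le_one_left' hle) (le_trans hS ?_)
      simpa using h
    · rw [htop, top_le_iff] at h
      rw [h]
      exact le_top
  · push Not at htriv
    obtain ⟨Θ, hΘm, hΘ⟩ := exists_thresholdFunction_of_two_le h1 h2 hα
      (Nat.one_le_iff_ne_zero.2 htriv.1) hx hx0 htriv.2 hy hy0 hya hxy
    refine ⟨_, ⟨Θ, hΘm, Or.inr rfl⟩, fun σ hσ => le_trans ?_ (hΘ σ hσ)⟩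
    gcongr ENNReal.ofReal ?_ * _
    -- The loss proved is 4/n; from n = 2 on, 4 ≤ (4 / log 2) log n.
    have hlog2 : 0 < Real.log 2 := Real.log_pos one_lt_two
    have hm2 : (2 : ℝ) ≤ (m + 1 : ℕ) := by
      have := Nat.one_le_iff_ne_zero.2 htriv.1
      exact_mod_cast (by omega : 2 ≤ m + 1)
    have hlog : Real.log 2 ≤ Real.log (m + 1 : ℕ) := Real.log_le_log two_pos hm2
    have h4 : 4 ≤ 4 / Real.log 2 * Real.log (m + 1 : ℕ) := by
      rw [div_mul_eq_mul_div, le_div_iff₀ hlog2]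
      linarith
    have h5 : 4 / ((m + 1 : ℕ) : ℝ) ≤ 4 / Real.log 2 * Real.log (m + 1 : ℕ) / (m + 1 : ℕ) :=
      div_le_div_of_nonneg_right h4 (by positivity)
    push_cast at h5 ⊢
    linarith

end DelegatedSearch

theorem mainTheorem1 :
    -- arbitrary joint distributions
    (∀ (n : ℕ) (Ω : Type u) [MeasurableSpace Ω] (μ : Fin n → Measure Ω)
        [∀ i, IsProbabilityMeasure (μ i)] (x : Ω → ℝ),
      1 ≤ n → Measurable x → (∀ ω, 0 ≤ x ω) →
      ∃ R : Set Ω, DelegatedSearch.IsThresholdSet x R ∧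
        ∀ y : Ω → ℝ, Measurable y → (∀ ω, 0 ≤ y ω) →
        ∀ σ : DelegatedSearch.Strategy (DelegatedSearch.singleProposal R) n,
          DelegatedSearch.IsBestResponse (DelegatedSearch.singleProposal R) y σ →
          DelegatedSearch.AdoptsWhenIndifferent (DelegatedSearch.singleProposal R) y σ →
          ENNReal.ofReal (1 / 2) * DelegatedSearch.searchValue μ x ≤
            DelegatedSearch.delegationValue μ x (DelegatedSearch.singleProposal R) σ) ∧
    -- independent atomless utilities, the principal observes only `x`
    (∀ (n : ℕ) (Ω : Type u) [MeasurableSpace Ω] (μ : Measure Ω)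
        [IsProbabilityMeasure μ] (x : Ω → ℝ),
      1 ≤ n → Measurable x → (∀ ω, 0 ≤ x ω) → DelegatedSearch.Atomless μ x →
      ∃ R : Set Ω, DelegatedSearch.IsThresholdSet x R ∧
        ∀ y : Ω → ℝ, Measurable y → (∀ ω, 0 ≤ y ω) → DelegatedSearch.Atomless μ y →
          IndepFun x y μ →
        ∀ σ : DelegatedSearch.Strategy (DelegatedSearch.singleProposal R) n,
          DelegatedSearch.IsBestResponse (DelegatedSearch.singleProposal R) y σ →
          ENNReal.ofReal (1 - 1 / Real.exp 1) *
              DelegatedSearch.searchValue (fun _ : Fin n => μ) x ≤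
            DelegatedSearch.delegationValue (fun _ : Fin n => μ) x
              (DelegatedSearch.singleProposal R) σ) ∧
    -- independent utilities, the principal observes `x` and `y`
    (∃ α : ℝ, 0.745 < α ∧ α < 0.746 ∧
      (∀ a : ℝ, 0 < a → a < 1 →
        ((∫ t in (0 : ℝ)..1, 1 / (t - t * Real.log t - 1 + 1 / a)) = 1 ↔ a = α)) ∧
      ∃ C : ℝ, ∀ (n : ℕ) (Ω : Type u) [MeasurableSpace Ω] (μ : Measure Ω)
          [IsProbabilityMeasure μ] (x y : Ω → ℝ),
        1 ≤ n → Measurable x → (∀ ω, 0 ≤ x ω) →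
        Measurable y → (∀ ω, 0 ≤ y ω) → DelegatedSearch.Atomless μ y →
        IndepFun x y μ →
        ∃ R : Set Ω, DelegatedSearch.IsThresholdFunctionSet x y R ∧
          ∀ σ : DelegatedSearch.Strategy (DelegatedSearch.singleProposal R) n,
            DelegatedSearch.IsBestResponse (DelegatedSearch.singleProposal R) y σ →
            ENNReal.ofReal (α - C * Real.log n / n) *
                DelegatedSearch.searchValue (fun _ : Fin n => μ) x ≤
              DelegatedSearch.delegationValue (fun _ : Fin n => μ) x
                (DelegatedSearch.singleProposal R) σ) := by
  refine ⟨?_, ?_, ?_⟩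
  · intro n Ω _ μ _ x hn hx _
    obtain ⟨R, hR, h⟩ := DelegatedSearch.exists_threshold_half μ hn hx
    exact ⟨R, hR, fun y _ hy0 σ hσ ha => h y hy0 σ hσ ha⟩
  · intro n Ω _ μ _ x hn hx hx0 hxa
    exact DelegatedSearch.exists_threshold_one_sub_inv_exp μ hn hx hx0 hxa
  · obtain ⟨α, h1, h2, hα, huniq⟩ := DelegatedSearch.exists_unique_hillKertz_eq_one
    refine ⟨α, h1, h2, huniq, 4 / Real.log 2, ?_⟩
    intro n Ω _ μ _ x y hn hx hx0 hy hy0 hya hxy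
    exact DelegatedSearch.exists_thresholdFunction h1 h2 hα hn hx hx0 hy hy0 hya hxy
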